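/- Let $B=\operatorname{Spec}A$ be an integral affine scheme over $\mathbb C$ and let $t\in A$ be a local parameter, i.e. $t:B\to\mathbb A^1_{\mathbb C}$ is a smooth morphism, with $\{t=0\}\neq\emptyset$ (the branch locus). Near a generic branch point the two sheets of the spectral cover $C\to B$ that come together, and the fibration $Y\to B$ by surfaces in which two lines come together, are given by the standard local models $$C=\operatorname{Spec}A[s]/(t-s^2),\qquad Y=\operatorname{Spec}A[x,y,z]/(t-x^2+y^2-z^2).$$ Put $\widehat Y=Y\times_BC$, with projections $\pi_1:\widehat Y\to Y$ and $\pi_2:\widehat Y\to C$. Let $R=C\times\mathbb A^1$, with coordinate $v$ on $\mathbb A^1$, be the family of lines, embedded in $Y$ by $(x,y,z)=(v,v,s)$. Let $\widehat R=R\times_BC\subset\widehat Y$, and let $D\subset\widehat Y$ be the preimage in $\widehat R$ of the diagonal $\Delta\subset C\times_BC$. Let $I_D\subset\mathcal O_{\widehat Y}$ be its ideal and $\mathcal O(D)$ the sheaf of rational functions $f$ with $f\cdot I_D\subset\mathcal O_{\widehat Y}$. Then: 1. $\widehat Y$ is integral. The functions $(x,y,z,s)$ define a smooth morphism from $\widehat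 Y$ to the conifold $\operatorname{Spec}\mathbb C[x,y,z,s]/(s^2-x^2+y^2-z^2)$, which is an isomorphism for $A=\mathbb C[t]$. The singular locus of $\widehat Y$ (the set of points where $\widehat Y$ is not smooth over $\mathbb C$) is the non-empty set $V(x,y,z,s)$, i.e. the preimage of the vertex of the conifold, and each of its components has codimension three. So $\widehat Y$ has conifold singularities in codimension three. 2. $I_D=(x-y,\,z-s)$ is a prime ideal of height one, so $D$ is a prime Weil divisor; $D$ is Cartier at a point $p\in\widehat Y$ if and only if $p\notin V(x,y,z,s)$. 3. $\mathcal O(D)$ is coherent of rank one; it is locally free (of rank one) at a point $p\in\widehat Y$ if and only if $p\notin V(x,y,z,s)$. 4. Nevertheless $\pi_{1*}\mathcal O(D)\cong\mathcal O_Y\oplus\mathcal O_Y$ as $\mathcal O_Y$-modules. More generally, for every Poincaré sheaf $\mathcal P=\mathcal O(D)\otimes\mathcal M$ with $\mathcal M$ a line bundle on $\widehat Y$, the sheaf $\pi_{1*}\mathcal P$ is locally isomorphic to $\mathcal O_Y\oplus\mathcal O_Y$. 5. For every such $\mathcal P$ and every line bundle $L$ on $C$, the transform $\mathbf T(L)=\pi_{1*}(\pi_2^*L\otimes\mathcal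 P)$ is locally isomorphic to $\mathcal O_Y\oplus\mathcal O_Y$, i.e. it is a vector bundle of rank two on $Y$. 6. The ideal $(x-y,\,z+s)$ of $\mathbb C[x,y,z,s]/(s^2-x^2+y^2-z^2)$ is a free $\mathbb C[x,y,z]$-module of rank two with basis $x-y,\ z+s$. -/

import Mathlib

open scoped TensorProduct

universe u v w

namespace ADETransform

noncomputable section

/-! ### Local freeness and the Cartier condition on an affine scheme -/

/-- The sheaf on `Spec R` given by the module `M` is free of rank `n` on a basic open
neighbourhood of the point `p`. -/
def LocallyFreeOfRankAt (R : Type u) [CommRing R] (M : Type v) [AddCommGroup M] [Module R M]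
    (n : ℕ) (p : PrimeSpectrum R) : Prop :=
  ∃ f : R, f ∉ p.asIdeal ∧
    Nonempty (LocalizedModule (Submonoid.powers f) M ≃ₗ[Localization (Submonoid.powers f)]
      (Fin n → Localization (Submonoid.powers f)))

/-- The closed subscheme of `Spec R` with ideal `I` is cut out by a single non-zero-divisor on a
basic open neighbourhood of the point `p`. -/
def CartierAt (R : Type u) [CommRing R] (I : Ideal R) (p : PrimeSpectrum R) : Prop :=
  ∃ f : R, f ∉ p.asIdeal ∧ ∃ g ∈ nonZeroDivisors (Localization.Away f),
    I.map (algebraMap R (Localization.Away f)) = Ideal.span {g}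

/-- `O(D)` for a divisor `D` with ideal `I = O(-D)`: the rational functions `f` all of whose
products with local equations of `D` are regular. -/
def divisorialSheaf (R : Type u) [CommRing R] (I : Ideal R) :
    Submodule R (FractionRing R) where
  carrier := {f | ∀ g ∈ I, ∃ r : R, algebraMap R (FractionRing R) g * f =
    algebraMap R (FractionRing R) r}
  zero_mem' := fun g _ => ⟨0, by simp⟩
  add_mem' := by
    intro a b ha hb g hg
    obtain ⟨r, hr⟩ := ha g hg
    obtain ⟨r', hr'⟩ := hb g hg
    exact ⟨r + r', by rw [mul_add, hr, hr', map_add]⟩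
  smul_mem' := by
    intro c a ha g hg
    obtain ⟨r, hr⟩ := ha g hg
    exact ⟨c * r, by rw [mul_smul_comm, hr, Algebra.smul_def, map_mul]⟩

/-! ### The conifold `s² = x² - y² + z²` -/

/-- The coordinate ring `ℂ[x, y, z, s] / (s² - x² + y² - z²)`; the variables `x, y, z, s` are
numbered `0, 1, 2, 3`. -/
def Conifold : Type :=
  MvPolynomial (Fin 4) ℂ ⧸ Ideal.span {(MvPolynomial.X 3 ^ 2 - MvPolynomial.X 0 ^ 2
    + MvPolynomial.X 1 ^ 2 - MvPolynomial.X 2 ^ 2 : MvPolynomial (Fin 4) ℂ)}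

namespace Conifold

instance : CommRing Conifold := inferInstanceAs (CommRing (_ ⧸ _))

instance : Algebra ℂ Conifold := inferInstanceAs (Algebra ℂ (_ ⧸ _))

/-- The coordinate functions `x, y, z, s` on the conifold. -/
def coord (i : Fin 4) : Conifold := Ideal.Quotient.mk _ (MvPolynomial.X i)

/-- `ℂ[x, y, z] → ℂ[x, y, z, s] / (s² - x² + y² - z²)`. -/
def fromXYZ : MvPolynomial (Fin 3) ℂ →ₐ[ℂ] Conifold :=
  MvPolynomial.aeval ![coord 0, coord 1, coord 2]

instance : Algebra (MvPolynomial (Fin 3) ℂ) Conifold := fromXYZ.toRingHom.toAlgebra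

/-- The ideal `(x - y, z + s)`. -/
def idealDPrime : Ideal Conifold := Ideal.span {coord 0 - coord 1, coord 2 + coord 3}

end Conifold

/-! ### The spectral cover, the surface fibration and their fibre product

`A` is the coordinate ring of the base `B` and `t : A` is a local parameter. -/

variable (A : Type u) [CommRing A] (t : A)

/-- The coordinate ring `A[s] / (t - s²)` of the spectral cover `C`. -/
def CoverRing : Type u :=
  Polynomial A ⧸ Ideal.span {(Polynomial.C t - Polynomial.X ^ 2 : Polynomial A)}

namespace CoverRing

instance : CommRing (CoverRing A t) := inferInstanceAs (CommRing (_ ⧸ _))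

instance : Algebra A (CoverRing A t) := inferInstanceAs (Algebra A (_ ⧸ _))

/-- The function `s` on `C`. -/
def s : CoverRing A t := Ideal.Quotient.mk _ Polynomial.X

lemma s_sq : s A t ^ 2 = algebraMap A (CoverRing A t) t := by
  have h : Ideal.Quotient.mk (Ideal.span {(Polynomial.C t - Polynomial.X ^ 2 : Polynomial A)})
      (Polynomial.C t - Polynomial.X ^ 2) = 0 :=
    Ideal.Quotient.eq_zero_iff_mem.mpr (Ideal.subset_span rfl)
  rw [map_sub, map_pow, sub_eq_zero] at h
  exact h.symm

end CoverRing

/-- The coordinate ring `A[x, y, z] / (t - x² + y² - z²)` of `Y`. -/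
def SurfaceRing : Type u :=
  MvPolynomial (Fin 3) A ⧸ Ideal.span {(MvPolynomial.C t - MvPolynomial.X 0 ^ 2
    + MvPolynomial.X 1 ^ 2 - MvPolynomial.X 2 ^ 2 : MvPolynomial (Fin 3) A)}

namespace SurfaceRing

instance : CommRing (SurfaceRing A t) := inferInstanceAs (CommRing (_ ⧸ _))

instance : Algebra A (SurfaceRing A t) := inferInstanceAs (Algebra A (_ ⧸ _))

/-- The functions `x, y, z` on `Y`. -/
def coord (i : Fin 3) : SurfaceRing A t := Ideal.Quotient.mk _ (MvPolynomial.X i)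

lemma relation :
    coord A t 0 ^ 2 - coord A t 1 ^ 2 + coord A t 2 ^ 2 = algebraMap A (SurfaceRing A t) t := by
  have h : Ideal.Quotient.mk (Ideal.span {(MvPolynomial.C t - MvPolynomial.X 0 ^ 2
      + MvPolynomial.X 1 ^ 2 - MvPolynomial.X 2 ^ 2 : MvPolynomial (Fin 3) A)})
      (MvPolynomial.C t - MvPolynomial.X 0 ^ 2 + MvPolynomial.X 1 ^ 2 - MvPolynomial.X 2 ^ 2)
      = 0 :=
    Ideal.Quotient.eq_zero_iff_mem.mpr (Ideal.subset_span rfl)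
  simp only [map_sub, map_add, map_pow] at h
  have h' : algebraMap A (SurfaceRing A t) t - coord A t 0 ^ 2 + coord A t 1 ^ 2
      - coord A t 2 ^ 2 = 0 := h
  linear_combination -h'

end SurfaceRing

/-- The coordinate ring of the fibre product `Ŷ = Y ×_B C`. -/
def HatRing : Type u := SurfaceRing A t ⊗[A] CoverRing A t

namespace HatRing

instance : CommRing (HatRing A t) := inferInstanceAs (CommRing (_ ⊗[A] _))

instance : Algebra A (HatRing A t) := inferInstanceAs (Algebra A (_ ⊗[A] _))

/-- Pullback of functions along the projection `Ŷ → Y`. -/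
def fromSurface : SurfaceRing A t →ₐ[A] HatRing A t :=
  (Algebra.TensorProduct.includeLeft :
    SurfaceRing A t →ₐ[A] SurfaceRing A t ⊗[A] CoverRing A t)

/-- Pullback of functions along the projection `Ŷ → C`. -/
def fromCover : CoverRing A t →ₐ[A] HatRing A t :=
  (Algebra.TensorProduct.includeRight :
    CoverRing A t →ₐ[A] SurfaceRing A t ⊗[A] CoverRing A t)

instance : Algebra (SurfaceRing A t) (HatRing A t) := (fromSurface A t).toRingHom.toAlgebra

instance : Algebra (CoverRing A t) (HatRing A t) := (fromCover A t).toRingHom.toAlgebra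

instance [Algebra ℂ A] : Algebra ℂ (HatRing A t) :=
  ((algebraMap A (HatRing A t)).comp (algebraMap ℂ A)).toAlgebra

/-- The functions `x, y, z, s` on `Ŷ`. -/
def coord : Fin 4 → HatRing A t :=
  ![fromSurface A t (SurfaceRing.coord A t 0), fromSurface A t (SurfaceRing.coord A t 1),
    fromSurface A t (SurfaceRing.coord A t 2), fromCover A t (CoverRing.s A t)]

lemma relation :
    coord A t 3 ^ 2 - coord A t 0 ^ 2 + coord A t 1 ^ 2 - coord A t 2 ^ 2 = 0 := by
  have h1 : fromCover A t (CoverRing.s A t) ^ 2 = algebraMap A (HatRing A t) t := by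
    rw [← map_pow, CoverRing.s_sq, AlgHom.commutes]
  have h2 := congrArg (fromSurface A t) (SurfaceRing.relation A t)
  rw [AlgHom.commutes] at h2
  simp only [map_add, map_sub, map_pow] at h2
  simp only [coord, Matrix.cons_val]
  linear_combination h1 - h2

/-- The ideal `(x, y, z, s)` of the subset of `Ŷ` where the functions `x, y, z, s` vanish. -/
def idealVertex : Ideal (HatRing A t) := Ideal.span (Set.range (coord A t))

end HatRing

/-- The morphism from `Ŷ` to the conifold given by the functions `x, y, z, s`. -/
def toConifold [Algebra ℂ A] : Conifold →+* HatRing A t :=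
  Ideal.Quotient.lift _ (MvPolynomial.aeval (R := ℂ) (HatRing.coord A t)).toRingHom (by
    intro a ha
    rw [← RingHom.mem_ker]
    revert a ha
    rw [← SetLike.le_def, Ideal.span_le, Set.singleton_subset_iff, SetLike.mem_coe,
      RingHom.mem_ker]
    have h := HatRing.relation A t
    simp only [AlgHom.toRingHom_eq_coe, RingHom.coe_coe, map_sub, map_add, map_pow,
      MvPolynomial.aeval_X]
    exact h)

/-! ### The universal line `D ⊂ Ŷ` -/

/-- The coordinate ring `O_C[v]` of the cylinder `R`, a family of lines over `C`. -/
abbrev CylinderRing : Type u := Polynomial (CoverRing A t)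

/-- Restriction of functions along the embedding `R ↪ Y`: `(x, y, z) ↦ (v, v, s)`. -/
def restrictToCylinder : SurfaceRing A t →ₐ[A] CylinderRing A t :=
  Ideal.Quotient.liftₐ _ (MvPolynomial.aeval
      ![Polynomial.X, Polynomial.X, Polynomial.C (CoverRing.s A t)]) (by
    intro a ha
    rw [← RingHom.mem_ker]
    revert a ha
    rw [← SetLike.le_def, Ideal.span_le, Set.singleton_subset_iff, SetLike.mem_coe,
      RingHom.mem_ker]
    have h : Polynomial.C (CoverRing.s A t) ^ 2 = algebraMap A (CylinderRing A t) t := by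
      rw [← map_pow, CoverRing.s_sq]
      rfl
    simp [h])

/-- Restriction of functions along the embedding of `R̂ = R ×_B C` in `Ŷ = Y ×_B C`. -/
def restrictToHatCylinder : HatRing A t →ₐ[A] CylinderRing A t ⊗[A] CoverRing A t :=
  Algebra.TensorProduct.map (restrictToCylinder A t) (AlgHom.id A (CoverRing A t))

/-- Pullback of functions along the projection `R̂ = R ×_B C → C ×_B C`. -/
def pullbackToHatCylinder :
    CoverRing A t ⊗[A] CoverRing A t →ₐ[A] CylinderRing A t ⊗[A] CoverRing A t :=
  Algebra.TensorProduct.map (IsScalarTower.toAlgHom A (CoverRing A t) (CylinderRing A t))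
    (AlgHom.id A (CoverRing A t))

/-- The ideal of the diagonal `Δ ⊂ C ×_B C`. -/
def idealDiagonal : Ideal (CoverRing A t ⊗[A] CoverRing A t) :=
  RingHom.ker (Algebra.TensorProduct.lmul' A : _ →ₐ[A] CoverRing A t)

/-- The ideal of `D ⊂ Ŷ`: the preimage of `Δ` in `R̂`, embedded in `Ŷ`. -/
def idealD : Ideal (HatRing A t) :=
  ((idealDiagonal A t).map (pullbackToHatCylinder A t)).comap (restrictToHatCylinder A t)

/-- The sheaf `O(D)` on `Ŷ`. -/
abbrev sheafD : Submodule (HatRing A t) (FractionRing (HatRing A t)) :=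
  divisorialSheaf (HatRing A t) (idealD A t)

/-! ### The transform -/

/-- The Poincaré sheaf `O(D) ⊗ M` on `Ŷ`, with a twist `M`. -/
abbrev poincareSheaf (M : Type v) [AddCommGroup M] [Module (HatRing A t) M] : Type (max u v) :=
  sheafD A t ⊗[HatRing A t] M

/-- The pullback to `Ŷ` of the sheaf `L` on `C`. -/
abbrev pullbackFromCover (L : Type w) [AddCommGroup L] [Module (CoverRing A t) L] :
    Type (max u w) :=
  HatRing A t ⊗[CoverRing A t] L

/-- `π₂^* L ⊗ P` for the twisted Poincaré sheaf `P = O(D) ⊗ M`, a sheaf on `Ŷ`. -/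
abbrev kernelSheaf (M : Type v) [AddCommGroup M] [Module (HatRing A t) M]
    (L : Type w) [AddCommGroup L] [Module (CoverRing A t) L] : Type (max u v w) :=
  pullbackFromCover A t L ⊗[HatRing A t] poincareSheaf A t M

/-- The pushforward to `Y` of a sheaf `N` on `Ŷ`: the same group, regarded as a module over the
functions on `Y`. -/
def Pushforward (N : Type v) [AddCommGroup N] [Module (HatRing A t) N] : Type v := N

variable (N : Type v) [AddCommGroup N] [Module (HatRing A t) N]

instance : AddCommGroup (Pushforward A t N) := inferInstanceAs (AddCommGroup N)

instance : Module (SurfaceRing A t) (Pushforward A t N) :=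
  Module.compHom N (algebraMap (SurfaceRing A t) (HatRing A t))

/-- The transform `T(L) = π₁_* (π₂^* L ⊗ P)`. -/
abbrev transform (M : Type v) [AddCommGroup M] [Module (HatRing A t) M]
    (L : Type w) [AddCommGroup L] [Module (CoverRing A t) L] : Type (max u v w) :=
  Pushforward A t (kernelSheaf A t M L)

end

end ADETransform

namespace ADETransform
noncomputable section

/-! ### Smooth algebras over an algebraically closed field are reduced -/

/-! Everything rests on the identity (x - y)(x + y) = -(z - s)(z + s) on `Ŷ`. It exhibits the
families of lines (x ∓ y, z ∓ s), whose ideals `lineIdeal` are kernels of restriction maps to O_C[v]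
(`ker_toLine`) and hence prime as soon as C is integral. The divisor of x - y is D + D' with D' = (x
- y, z + s), so multiplication by x - y identifies O(D) with the ideal of D'
(`exists_linearEquiv_sheafD`). Statements about O(D) thereby become statements about the ideal of a
line.

Away from the vertex one of the four linear factors is invertible, and the ideal of a line is then
trivial or generated by one of its two generators. At the vertex a single local equation would give
the ratio of the two generators a numerator and a denominator that are not both in the vertex ideal,
whereas primality of the neighbouring lines forces both into it (`cartierAt_lineIdeal_iff`).

The pushforward is nevertheless free: `Ŷ` → Y is a double cover with basis 1, s, and the O_Y-span of
x - y and z + s is already stable under multiplication by s (`exists_basis_span_pair`). A line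
bundle on `Ŷ` is trivial along the whole fibre over a point of Y, because a finite algebra over a
local ring is semilocal (`exists_generator_of_invertible`); so twists do not matter, and the
pullback of L is just one more twist.

Integrality of C means that t is not a square in the fraction field of A; this follows by descent
from reducedness of A/(t) (`eq_zero_of_mul_sq_eq_sq`). Integrality of `Ŷ` follows in the coordinates
x ± y. Since `Ŷ` is the base change of t : B → 𝔸¹ along s² from the conifold, it is smooth over the
conifold. A Newton step proves smoothness away from the vertex. At the vertex, a lift to the
second-order neighbourhood of the quadric hypersurface is impossible
(`false_of_algHom_quotient_quadric`). The heights come from Krull's theorem and an explicit chain of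
primes. -/

theorem isReduced_of_smooth (k : Type*) [Field k] [IsAlgClosed k] (S : Type*) [CommRing S]
    [Algebra k S] [Algebra.Smooth k S] : IsReduced S := by
  refine ⟨fun a ha ↦ ?_⟩
  -- Integral closure commutes with smooth base change, and k is integrally closed in k[X]. If a is
  -- nilpotent, a ⊗ X is nilpotent, hence integral over S, hence comes from S ⊗ k; comparing
  -- coefficients of X gives a = 0.
  have hbij := TensorProduct.toIntegralClosure_bijective_of_smooth (R := k) (S := S)
    (B := Polynomial k)
  have hnil : IsNilpotent (a ⊗ₜ[k] (Polynomial.X : Polynomial k)) := by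
    obtain ⟨n, hn⟩ := ha
    exact ⟨n, by rw [Algebra.TensorProduct.tmul_pow, hn, TensorProduct.zero_tmul]⟩
  have hint : IsIntegral S (a ⊗ₜ[k] (Polynomial.X : Polynomial k)) := by
    obtain ⟨n, hn⟩ := hnil
    exact ⟨Polynomial.X ^ n, Polynomial.monic_X_pow n, by simp [hn]⟩
  obtain ⟨y, hy⟩ := hbij.2 ⟨_, hint⟩
  have hconst : ∀ p : integralClosure k (Polynomial k), (p : Polynomial k).coeff 1 = 0 := by
    intro p
    obtain ⟨c, hc⟩ := (IsAlgClosed.algebraMap_bijective_of_isIntegral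
      (k := k) (K := integralClosure k (Polynomial k))).2 p
    rw [← hc]
    exact Polynomial.coeff_C_succ
  have hy' := congrArg Subtype.val hy
  let ψ : S ⊗[k] Polynomial k →ₗ[k] S ⊗[k] k := LinearMap.lTensor S (Polynomial.lcoeff k 1)
  have hz : ∀ y : S ⊗[k] integralClosure k (Polynomial k),
      ψ (TensorProduct.toIntegralClosure k S (Polynomial k) y).1 = 0 := by
    intro y
    induction y with
    | zero => simp
    | add x y hx hy => rw [map_add, Subalgebra.coe_add, map_add, hx, hy, add_zero]
    | tmul x y =>
      have : (TensorProduct.toIntegralClosure k S (Polynomial k) (x ⊗ₜ y)).1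
          = x ⊗ₜ[k] (y : Polynomial k) := rfl
      rw [this]
      simp [ψ, hconst]
  have h1 := hz y
  rw [hy'] at h1
  have h2 : ψ (a ⊗ₜ[k] (Polynomial.X : Polynomial k)) = a ⊗ₜ[k] (1 : k) := by
    simp [ψ]
  rw [h2] at h1
  simpa using congrArg (TensorProduct.rid k S) h1

theorem isReduced_of_ringHom_smooth {k S : Type*} [Field k] [IsAlgClosed k] [CommRing S]
    {f : k →+* S} (hf : f.Smooth) : IsReduced S := by
  algebraize [f]
  exact isReduced_of_smooth k S

/-! ### Smooth local parameters -/

section Parameter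

variable {A : Type u} [CommRing A] [Algebra ℂ A] {t : A}

/-- A/(t) is the base change of ℂ[X] → A along X ↦ 0, so it is smooth over ℂ. -/
theorem isReduced_quotient_span_of_smooth
    (ht : (Polynomial.aeval t : Polynomial ℂ →ₐ[ℂ] A).toRingHom.Smooth) :
    IsReduced (A ⧸ Ideal.span {t}) := by
  let I : Ideal (Polynomial ℂ) := Ideal.span {Polynomial.X}
  let := (Polynomial.aeval t : Polynomial ℂ →ₐ[ℂ] A).toRingHom.toAlgebra
  have : Algebra.Smooth (Polynomial ℂ) A := ht
  have hI : I.map (algebraMap (Polynomial ℂ) A) = Ideal.span {t} := by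
    rw [Ideal.map_span, Set.image_singleton]
    congr 2
    exact Polynomial.aeval_X t
  rw [← hI]
  have e := Algebra.TensorProduct.quotIdealMapEquivTensorQuot A I
  have h1 : (algebraMap (Polynomial ℂ ⧸ I) ((Polynomial ℂ ⧸ I) ⊗[Polynomial ℂ] A)).Smooth := by
    rw [RingHom.smooth_algebraMap]
    infer_instance
  have hI0 : I = RingHom.ker (Polynomial.aeval (0 : ℂ) : Polynomial ℂ →ₐ[ℂ] ℂ).toRingHom := by
    ext p
    rw [RingHom.mem_ker, Ideal.mem_span_singleton, Polynomial.X_dvd_iff]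
    simp [Polynomial.coeff_zero_eq_eval_zero]
  have hs : Function.Surjective (Polynomial.aeval (0 : ℂ) : Polynomial ℂ →ₐ[ℂ] ℂ).toRingHom :=
    fun c ↦ ⟨Polynomial.C c, by simp⟩
  let e0 : (Polynomial ℂ ⧸ I) ≃+* ℂ :=
    (Ideal.quotEquivOfEq hI0).trans (RingHom.quotientKerEquivOfSurjective hs)
  have h2 : (RingHom.comp (algebraMap (Polynomial ℂ ⧸ I) ((Polynomial ℂ ⧸ I) ⊗[Polynomial ℂ] A))
      e0.symm.toRingHom).Smooth := by
    refine RingHom.Smooth.comp (RingHom.smooth_def.2 ⟨?_, ?_⟩) h1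
    · exact .of_bijective e0.symm.bijective
    · exact .of_bijective e0.symm.bijective
  have := isReduced_of_ringHom_smooth h2
  let e' := (e.toRingEquiv).trans
    (Algebra.TensorProduct.comm (Polynomial ℂ) A (Polynomial ℂ ⧸ I)).toRingEquiv
  exact isReduced_of_injective e'.toRingHom e'.injective

theorem isNoetherianRing_of_smooth
    (ht : (Polynomial.aeval t : Polynomial ℂ →ₐ[ℂ] A).toRingHom.Smooth) : IsNoetherianRing A := by
  let := (Polynomial.aeval t : Polynomial ℂ →ₐ[ℂ] A).toRingHom.toAlgebra
  have : Algebra.Smooth (Polynomial ℂ) A := ht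
  exact Algebra.FiniteType.isNoetherianRing (Polynomial ℂ) A

/-- This says that t is not a square in the fraction field. Since A/(t) is reduced, t divides every
element whose square it divides; so t divides a, then b, and cancelling t² reproduces the equation.
Thus b is divisible by all powers of t, and Krull's intersection theorem applies. That t ≠ 0 comes
from injectivity of the smooth map ℂ[X] → A. -/
theorem eq_zero_of_mul_sq_eq_sq [IsDomain A]
    (ht : (Polynomial.aeval t : Polynomial ℂ →ₐ[ℂ] A).toRingHom.Smooth) (ht₀ : ¬ IsUnit t)
    {a b : A} (h : t * b ^ 2 = a ^ 2) : b = 0 := by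
  have := isReduced_quotient_span_of_smooth ht
  have : IsNoetherianRing A := isNoetherianRing_of_smooth ht
  have hdvd : ∀ {c d : A}, t * d = c ^ 2 → t ∣ c := by
    intro c d hcd
    rw [← Ideal.mem_span_singleton, ← Ideal.Quotient.eq_zero_iff_mem]
    have : (Ideal.Quotient.mk (Ideal.span {t}) c) ^ 2 = 0 := by
      rw [← map_pow, ← hcd, Ideal.Quotient.eq_zero_iff_mem]
      exact Ideal.mul_mem_right _ _ (Ideal.mem_span_singleton_self t)
    exact pow_eq_zero_iff two_ne_zero |>.mp this
  by_cases h0 : t = 0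
  · have hinj : Function.Injective (Polynomial.aeval t : Polynomial ℂ →ₐ[ℂ] A) := by
      let := (Polynomial.aeval t : Polynomial ℂ →ₐ[ℂ] A).toRingHom.toAlgebra
      have : Algebra.Smooth (Polynomial ℂ) A := ht
      exact FaithfulSMul.algebraMap_injective (Polynomial ℂ) A
    have := hinj (a₁ := Polynomial.X) (a₂ := 0) (by simp [h0])
    exact absurd this Polynomial.X_ne_zero
  have key : ∀ n : ℕ, ∀ a b : A, t * b ^ 2 = a ^ 2 → t ^ n ∣ b := by
    intro n
    induction n with
    | zero => intro a b _; simp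
    | succ n ih =>
      intro a b h
      obtain ⟨a', rfl⟩ := hdvd h
      have h1 : b ^ 2 = t * a' ^ 2 := mul_left_cancel₀ h0 (by linear_combination h)
      obtain ⟨b', rfl⟩ := hdvd h1.symm
      have h2 : t * b' ^ 2 = a' ^ 2 := mul_left_cancel₀ h0 (by linear_combination h1)
      rw [pow_succ']
      exact mul_dvd_mul_left t (ih a' b' h2)
  have hinf := Ideal.iInf_pow_eq_bot_of_isDomain (Ideal.span {t})
    (by rwa [Ne, Ideal.span_singleton_eq_top])
  have : b ∈ (⨅ i : ℕ, Ideal.span {t} ^ i : Ideal A) := by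
    rw [Ideal.mem_iInf]
    intro n
    rw [Ideal.span_singleton_pow, Ideal.mem_span_singleton]
    exact key n a b h
  rwa [hinf] at this

end Parameter

/-! ### The double cover -/

namespace CoverRing

variable {D : Type u} [CommRing D] {c : D}

variable (D c) in
/-- The quotient map `D[X] → D[s] / (c - s²)`. -/
def mk : Polynomial D →+* CoverRing D c := Ideal.Quotient.mk _

theorem mk_surjective : Function.Surjective (mk D c) := Ideal.Quotient.mk_surjective

theorem mk_C (a : D) : mk D c (Polynomial.C a) = algebraMap D _ a := rfl

theorem mk_X : mk D c Polynomial.X = s D c := rfl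

theorem mk_eq_zero {p : Polynomial D} :
    mk D c p = 0 ↔ Polynomial.X ^ 2 - Polynomial.C c ∣ p := by
  rw [← neg_dvd, neg_sub, ← Ideal.mem_span_singleton]
  exact Ideal.Quotient.eq_zero_iff_mem

theorem exists_eq_add_mul_s (r : CoverRing D c) :
    ∃ a b : D, r = algebraMap D _ a + algebraMap D _ b * s D c := by
  obtain ⟨p, rfl⟩ := mk_surjective r
  induction p using Polynomial.induction_on' with
  | add p q hp hq =>
    obtain ⟨a, b, h⟩ := hp
    obtain ⟨a', b', h'⟩ := hq
    exact ⟨a + a', b + b', by rw [map_add, h, h', map_add, map_add]; ring⟩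
  | monomial n d =>
    rw [← Polynomial.C_mul_X_pow_eq_monomial, map_mul, map_pow, mk_C, mk_X]
    obtain ⟨k, rfl | rfl⟩ := Nat.even_or_odd' n
    · exact ⟨d * c ^ k, 0, by rw [pow_mul, s_sq, map_mul, map_pow, map_zero]; ring⟩
    · exact ⟨0, d * c ^ k, by rw [pow_succ, pow_mul, s_sq, map_mul, map_pow, map_zero]; ring⟩

/-- A monic quadratic divides no nonzero polynomial of degree at most one. The base D is left
general because Y, affine three-space and a plane over C also serve as bases of double covers. -/
theorem add_mul_s_eq_zero {a b : D}
    (h : algebraMap D (CoverRing D c) a + algebraMap D _ b * s D c = 0) : a = 0 ∧ b = 0 := by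
  have h' : mk D c (Polynomial.C b * Polynomial.X + Polynomial.C a) = 0 := by
    rw [map_add, map_mul, add_comm, mk_C, mk_C, mk_X, h]
  rw [mk_eq_zero] at h'
  nontriviality D
  have h0 : Polynomial.C b * Polynomial.X + Polynomial.C a = 0 := by
    by_contra hne
    refine (Polynomial.monic_X_pow_sub_C c two_ne_zero).not_dvd_of_degree_lt hne ?_ h'
    rw [Polynomial.degree_X_pow_sub_C two_pos]
    exact Polynomial.degree_linear_le.trans_lt (by norm_num)
  constructor
  · simpa using congrArg (fun p ↦ Polynomial.coeff p 0) h0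
  · simpa using congrArg (fun p ↦ Polynomial.coeff p 1) h0

theorem s_ne_zero [Nontrivial D] : s D c ≠ 0 := by
  intro h
  have := (add_mul_s_eq_zero (c := c) (a := 0) (b := 1) (by simp [h])).2
  exact one_ne_zero this

theorem algebraMap_injective : Function.Injective (algebraMap D (CoverRing D c)) := by
  rw [injective_iff_map_eq_zero]
  intro a ha
  exact (add_mul_s_eq_zero (c := c) (a := a) (b := 0) (by simp [ha])).1

/-- The norm a² - c b² of a + b s is multiplicative, and by hypothesis it vanishes only at zero. -/
theorem isDomain [IsDomain D] (hc : ∀ a b : D, c * b ^ 2 = a ^ 2 → b = 0) :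
    IsDomain (CoverRing D c) := by
  have : Nontrivial (CoverRing D c) := algebraMap_injective.nontrivial
  have key : ∀ a b : D, a ^ 2 - c * b ^ 2 = 0 → a = 0 ∧ b = 0 := by
    intro a b h
    have hb := hc a b (by linear_combination -h)
    subst hb
    exact ⟨by simpa using h, rfl⟩
  have : NoZeroDivisors (CoverRing D c) := by
    refine ⟨fun {p q} hpq ↦ ?_⟩
    obtain ⟨a, b, rfl⟩ := exists_eq_add_mul_s p
    obtain ⟨a', b', rfl⟩ := exists_eq_add_mul_s q
    have h1 : algebraMap D (CoverRing D c) ((a ^ 2 - c * b ^ 2) * (a' ^ 2 - c * b' ^ 2)) = 0 := by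
      simp only [map_mul, map_sub, map_pow, ← s_sq]
      linear_combination (algebraMap D (CoverRing D c) a - algebraMap D _ b * s D c) *
        (algebraMap D (CoverRing D c) a' - algebraMap D _ b' * s D c) * hpq
    rw [map_eq_zero_iff _ algebraMap_injective, mul_eq_zero] at h1
    refine h1.imp (fun h ↦ ?_) (fun h ↦ ?_)
    · obtain ⟨rfl, rfl⟩ := key _ _ h
      simp
    · obtain ⟨rfl, rfl⟩ := key _ _ h
      simp
  exact NoZeroDivisors.to_isDomain _

/-- Ring homomorphisms out of `D[s] / (c - s²)`. -/
def lift {B : Type*} [CommRing B] (f : D →+* B) (x : B) (hx : x ^ 2 = f c) : CoverRing D c →+* B :=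
  Ideal.Quotient.lift _ (Polynomial.eval₂RingHom f x) (by
    intro a ha
    obtain ⟨q, rfl⟩ := Ideal.mem_span_singleton.mp ha
    simp [hx])

section lift

variable {B : Type*} [CommRing B] (f : D →+* B) (x : B) (hx : x ^ 2 = f c)

@[simp] theorem lift_algebraMap (a : D) : lift f x hx (algebraMap D _ a) = f a :=
  (Ideal.Quotient.lift_mk _ _ _).trans (Polynomial.eval₂_C f x)

@[simp] theorem lift_s : lift f x hx (s D c) = x :=
  (Ideal.Quotient.lift_mk _ _ _).trans (Polynomial.eval₂_X f x)

theorem hom_ext {f g : CoverRing D c →+* B}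
    (h : f.comp (algebraMap D _) = g.comp (algebraMap D _)) (hs : f (s D c) = g (s D c)) :
    f = g := by
  ext r
  obtain ⟨a, b, rfl⟩ := exists_eq_add_mul_s r
  have h' (a : D) := RingHom.congr_fun h a
  simp only [RingHom.comp_apply] at h'
  simp [h', hs]

end lift

end CoverRing

end
end ADETransform

namespace ADETransform
noncomputable section

/-! ### Ring homomorphisms out of the coordinate rings -/

namespace SurfaceRing

variable {A : Type u} [CommRing A] {t : A} {D : Type*} [CommRing D]

theorem hom_ext {f g : SurfaceRing A t →+* D}
    (h : f.comp (algebraMap A _) = g.comp (algebraMap A _))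
    (hc : ∀ i, f (coord A t i) = g (coord A t i)) : f = g :=
  Ideal.Quotient.ringHom_ext (MvPolynomial.ringHom_ext (fun a ↦ RingHom.congr_fun h a) hc)

/-- Ring homomorphisms out of `A[x, y, z] / (t - x² + y² - z²)`. -/
def lift (f : A →+* D) (c : Fin 3 → D) (hc : c 0 ^ 2 - c 1 ^ 2 + c 2 ^ 2 = f t) :
    SurfaceRing A t →+* D :=
  Ideal.Quotient.lift _ (MvPolynomial.eval₂Hom f c) (by
    intro a ha
    obtain ⟨q, rfl⟩ := Ideal.mem_span_singleton.mp ha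
    simp only [map_mul, map_sub, map_add, map_pow, MvPolynomial.coe_eval₂Hom,
      MvPolynomial.eval₂_C, MvPolynomial.eval₂_X, ← hc]
    ring)

variable (f : A →+* D) (c : Fin 3 → D) (hc : c 0 ^ 2 - c 1 ^ 2 + c 2 ^ 2 = f t)

@[simp] theorem lift_algebraMap (a : A) : lift f c hc (algebraMap A _ a) = f a :=
  (Ideal.Quotient.lift_mk _ _ _).trans (MvPolynomial.eval₂_C f c a)

@[simp] theorem lift_coord (i : Fin 3) : lift f c hc (coord A t i) = c i :=
  (Ideal.Quotient.lift_mk _ _ _).trans (MvPolynomial.eval₂_X f c i)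

end SurfaceRing

namespace Conifold

variable {D : Type*} [CommRing D]

theorem relation : coord 3 ^ 2 - coord 0 ^ 2 + coord 1 ^ 2 - coord 2 ^ 2 = 0 :=
  Ideal.Quotient.eq_zero_iff_mem.mpr (Ideal.subset_span rfl)

theorem hom_ext {f g : Conifold →+* D}
    (h : f.comp (algebraMap ℂ _) = g.comp (algebraMap ℂ _))
    (hc : ∀ i, f (coord i) = g (coord i)) : f = g :=
  Ideal.Quotient.ringHom_ext (MvPolynomial.ringHom_ext (fun a ↦ RingHom.congr_fun h a) hc)

/-- Ring homomorphisms out of the coordinate ring of the conifold. -/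
def lift (f : ℂ →+* D) (c : Fin 4 → D) (hc : c 3 ^ 2 - c 0 ^ 2 + c 1 ^ 2 - c 2 ^ 2 = 0) :
    Conifold →+* D :=
  Ideal.Quotient.lift _ (MvPolynomial.eval₂Hom f c) (by
    intro a ha
    obtain ⟨q, rfl⟩ := Ideal.mem_span_singleton.mp ha
    simp only [map_mul, map_sub, map_add, map_pow, MvPolynomial.coe_eval₂Hom,
      MvPolynomial.eval₂_X, hc, zero_mul])

variable (f : ℂ →+* D) (c : Fin 4 → D) (hc : c 3 ^ 2 - c 0 ^ 2 + c 1 ^ 2 - c 2 ^ 2 = 0)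

@[simp] theorem lift_algebraMap (a : ℂ) : lift f c hc (algebraMap ℂ _ a) = f a :=
  (Ideal.Quotient.lift_mk _ _ _).trans (MvPolynomial.eval₂_C f c a)

@[simp] theorem lift_coord (i : Fin 4) : lift f c hc (coord i) = c i :=
  (Ideal.Quotient.lift_mk _ _ _).trans (MvPolynomial.eval₂_X f c i)

theorem algebraMap_eq_fromXYZ (p : MvPolynomial (Fin 3) ℂ) :
    algebraMap (MvPolynomial (Fin 3) ℂ) Conifold p = fromXYZ p := rfl

theorem exists_eq_add_mul_coord (r : Conifold) :
    ∃ a b : MvPolynomial (Fin 3) ℂ, r = algebraMap _ _ a + algebraMap _ _ b * coord 3 := by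
  have hrel : algebraMap (MvPolynomial (Fin 3) ℂ) Conifold
      (.X 0 ^ 2 - .X 1 ^ 2 + .X 2 ^ 2) = coord 3 ^ 2 := by
    simp only [algebraMap_eq_fromXYZ, fromXYZ, map_add, map_sub, map_pow, MvPolynomial.aeval_X]
    simp only [Matrix.cons_val]
    linear_combination -relation
  obtain ⟨p, rfl⟩ := Ideal.Quotient.mk_surjective r
  induction p using MvPolynomial.induction_on with
  | C c =>
    refine ⟨.C c, 0, ?_⟩
    rw [map_zero, zero_mul, add_zero, algebraMap_eq_fromXYZ]
    exact (fromXYZ.commutes c).symm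
  | add p q hp hq =>
    obtain ⟨a, b, h⟩ := hp
    obtain ⟨a', b', h'⟩ := hq
    refine ⟨a + a', b + b', ?_⟩
    rw [map_add, h, h', map_add (algebraMap _ Conifold), map_add (algebraMap _ Conifold)]
    exact (by intros; ring :
      ∀ x y z w s : Conifold, x + y * s + (z + w * s) = x + z + (y + w) * s) _ _ _ _ _
  | mul_X p i hp =>
    obtain ⟨a, b, h⟩ := hp
    rw [map_mul, h]
    change ∃ a' b', (_ : Conifold) * coord i = _
    have hi (j : Fin 3) (k : Fin 4)
        (hjk : algebraMap (MvPolynomial (Fin 3) ℂ) Conifold (.X j) = coord k) :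
        ∃ a' b' : MvPolynomial (Fin 3) ℂ, (algebraMap _ _ a + algebraMap _ _ b * coord 3) * coord k
          = algebraMap _ _ a' + algebraMap _ _ b' * coord 3 := by
      refine ⟨a * .X j, b * .X j, ?_⟩
      rw [map_mul, map_mul, hjk]
      ring
    have hX (j : Fin 3) : algebraMap (MvPolynomial (Fin 3) ℂ) Conifold (.X j) =
        ![coord 0, coord 1, coord 2] j := by
      rw [algebraMap_eq_fromXYZ, fromXYZ, MvPolynomial.aeval_X]
    fin_cases i
    · exact hi 0 0 (hX 0)
    · exact hi 1 1 (hX 1)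
    · exact hi 2 2 (hX 2)
    · refine ⟨b * (.X 0 ^ 2 - .X 1 ^ 2 + .X 2 ^ 2), a, ?_⟩
      rw [map_mul, hrel]
      exact (by intros; ring :
        ∀ a b s : Conifold, (a + b * s) * s = b * s ^ 2 + a * s) _ _ _

/-- The relation is mapped to the double cover of affine three-space branched along τ, where 1 and s
are known to be independent. -/
theorem add_mul_coord_eq_zero {a b : MvPolynomial (Fin 3) ℂ}
    (h : algebraMap _ Conifold a + algebraMap _ _ b * coord 3 = 0) : a = 0 ∧ b = 0 := by
  let τ : MvPolynomial (Fin 3) ℂ := .X 0 ^ 2 - .X 1 ^ 2 + .X 2 ^ 2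
  let al := algebraMap (MvPolynomial (Fin 3) ℂ) (CoverRing _ τ)
  let g : Conifold →+* CoverRing _ τ := lift (al.comp MvPolynomial.C)
    ![al (.X 0), al (.X 1), al (.X 2), CoverRing.s _ τ] (by
      simp only [Matrix.cons_val, CoverRing.s_sq]
      simp only [τ, al, map_add, map_sub, map_pow]
      ring)
  have hg : g.comp (algebraMap _ _) = al := by
    refine MvPolynomial.ringHom_ext (fun c ↦ ?_) (fun i ↦ ?_)
    · rw [RingHom.comp_apply, algebraMap_eq_fromXYZ]
      have : fromXYZ (MvPolynomial.C c) = algebraMap ℂ Conifold c := fromXYZ.commutes c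
      rw [this, lift_algebraMap, RingHom.comp_apply]
    · rw [RingHom.comp_apply, algebraMap_eq_fromXYZ, fromXYZ, MvPolynomial.aeval_X]
      fin_cases i
      · exact lift_coord _ _ _ 0
      · exact lift_coord _ _ _ 1
      · exact lift_coord _ _ _ 2
  have h' := congrArg g h
  have hga (a) : g (algebraMap _ _ a) = al a := RingHom.congr_fun hg a
  rw [map_add, map_mul, hga, hga, map_zero, lift_coord] at h'
  exact CoverRing.add_mul_s_eq_zero h'

end Conifold

namespace HatRing

variable {A : Type u} [CommRing A] {t : A} {D : Type*} [CommRing D]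

theorem fromSurface_coord (i : Fin 3) :
    fromSurface A t (SurfaceRing.coord A t i) = coord A t i.castSucc := by
  fin_cases i <;> rfl

theorem fromCover_s : fromCover A t (CoverRing.s A t) = coord A t 3 := rfl

theorem hom_ext_of_comp {f g : HatRing A t →+* D}
    (h : f.comp (fromSurface A t).toRingHom = g.comp (fromSurface A t).toRingHom)
    (h' : f.comp (fromCover A t).toRingHom = g.comp (fromCover A t).toRingHom) : f = g := by
  ext r
  induction r using TensorProduct.induction_on with
  | zero => exact (map_zero f).trans (map_zero g).symm
  | add x y hx hy => exact (map_add f x y).trans ((congrArg₂ _ hx hy).trans (map_add g x y).symm)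
  | tmul x y =>
    have hxy : (x ⊗ₜ[A] y : SurfaceRing A t ⊗[A] CoverRing A t) =
        (fromSurface A t x * fromCover A t y : HatRing A t) :=
      ((Algebra.TensorProduct.tmul_mul_tmul x 1 1 y).trans (by rw [mul_one, one_mul])).symm
    rw [hxy, map_mul, map_mul]
    exact congrArg₂ _ (RingHom.congr_fun h x) (RingHom.congr_fun h' y)

theorem hom_ext {f g : HatRing A t →+* D}
    (h : f.comp (algebraMap A _) = g.comp (algebraMap A _))
    (hc : ∀ i, f (coord A t i) = g (coord A t i)) : f = g := by
  have ha (a : A) := RingHom.congr_fun h a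
  refine hom_ext_of_comp (SurfaceRing.hom_ext ?_ fun i ↦ ?_) (CoverRing.hom_ext ?_ ?_)
  · ext a
    have := ha a
    rw [RingHom.comp_apply, RingHom.comp_apply, ← (fromSurface A t).commutes] at this
    exact this
  · have := hc i.castSucc
    rwa [← fromSurface_coord] at this
  · ext a
    have := ha a
    rw [RingHom.comp_apply, RingHom.comp_apply, ← (fromCover A t).commutes] at this
    exact this
  · exact hc 3

/-- Ring homomorphisms out of the coordinate ring of `Ŷ`. -/
def lift (f : A →+* D) (c : Fin 4 → D) (hs : c 3 ^ 2 = f t)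
    (hc : c 0 ^ 2 - c 1 ^ 2 + c 2 ^ 2 = f t) : HatRing A t →+* D :=
  letI := f.toAlgebra
  (Algebra.TensorProduct.productMap (R := A)
    ({ SurfaceRing.lift f ![c 0, c 1, c 2] hc with
      commutes' := fun a ↦ SurfaceRing.lift_algebraMap f ![c 0, c 1, c 2] hc a } :
      SurfaceRing A t →ₐ[A] D)
    ({ CoverRing.lift f (c 3) hs with
      commutes' := fun a ↦ CoverRing.lift_algebraMap f (c 3) hs a } :
      CoverRing A t →ₐ[A] D)).toRingHom

variable (f : A →+* D) (c : Fin 4 → D) (hs : c 3 ^ 2 = f t)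
    (hc : c 0 ^ 2 - c 1 ^ 2 + c 2 ^ 2 = f t)

theorem lift_fromSurface (a : SurfaceRing A t) :
    lift f c hs hc (fromSurface A t a) = SurfaceRing.lift f ![c 0, c 1, c 2] hc a := by
  let := f.toAlgebra
  exact Algebra.TensorProduct.productMap_left_apply _ _ a

theorem lift_fromCover (a : CoverRing A t) :
    lift f c hs hc (fromCover A t a) = CoverRing.lift f (c 3) hs a := by
  let := f.toAlgebra
  exact Algebra.TensorProduct.productMap_right_apply _ _ a

@[simp] theorem lift_algebraMap (a : A) : lift f c hs hc (algebraMap A _ a) = f a := by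
  rw [← (fromCover A t).commutes, lift_fromCover, CoverRing.lift_algebraMap]

@[simp] theorem lift_coord (i : Fin 4) : lift f c hs hc (coord A t i) = c i := by
  fin_cases i
  · exact (lift_fromSurface f c hs hc _).trans (SurfaceRing.lift_coord _ _ hc 0)
  · exact (lift_fromSurface f c hs hc _).trans (SurfaceRing.lift_coord _ _ hc 1)
  · exact (lift_fromSurface f c hs hc _).trans (SurfaceRing.lift_coord _ _ hc 2)
  · exact (lift_fromCover f c hs hc _).trans (CoverRing.lift_s _ _ hs)

theorem coord_three_sq : coord A t 3 ^ 2 = algebraMap A _ t := by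
  rw [← fromCover_s, ← map_pow, CoverRing.s_sq, AlgHom.commutes]

theorem exists_eq_add_mul_coord (r : HatRing A t) :
    ∃ a b : SurfaceRing A t, r = fromSurface A t a + fromSurface A t b * coord A t 3 := by
  induction r using TensorProduct.induction_on with
  | zero => exact ⟨0, 0, by simp; rfl⟩
  | add x y hx hy =>
    obtain ⟨a, b, h⟩ := hx
    obtain ⟨a', b', h'⟩ := hy
    refine ⟨a + a', b + b', ?_⟩
    rw [h, h', map_add, map_add]
    exact (by intros; ring :
      ∀ x y z w s : HatRing A t, x + y * s + (z + w * s) = x + z + (y + w) * s) _ _ _ _ _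
  | tmul x y =>
    have hxy : (x ⊗ₜ[A] y : SurfaceRing A t ⊗[A] CoverRing A t) =
        (fromSurface A t x * fromCover A t y : HatRing A t) :=
      ((Algebra.TensorProduct.tmul_mul_tmul x 1 1 y).trans (by rw [mul_one, one_mul])).symm
    obtain ⟨a, b, rfl⟩ := CoverRing.exists_eq_add_mul_s y
    refine ⟨x * algebraMap A _ a, x * algebraMap A _ b, ?_⟩
    rw [hxy, map_add, map_mul, map_mul, map_mul, AlgHom.commutes, AlgHom.commutes,
      AlgHom.commutes, AlgHom.commutes, fromCover_s]
    ring

/-- As for the conifold, independence is tested in the double cover of Y branched along t. -/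
theorem add_mul_coord_eq_zero {a b : SurfaceRing A t}
    (h : fromSurface A t a + fromSurface A t b * coord A t 3 = 0) : a = 0 ∧ b = 0 := by
  let τ := algebraMap A (SurfaceRing A t) t
  let al := algebraMap (SurfaceRing A t) (CoverRing _ τ)
  let x (i : Fin 3) := SurfaceRing.coord A t i
  let g : HatRing A t →+* CoverRing _ τ := lift (al.comp (algebraMap A _))
    ![al (x 0), al (x 1), al (x 2), CoverRing.s _ τ] (CoverRing.s_sq _ _) (by
      simp only [Matrix.cons_val, RingHom.comp_apply, ← SurfaceRing.relation]
      simp only [map_add, map_sub, map_pow]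
      rfl)
  have hg : g.comp (fromSurface A t).toRingHom = al := by
    refine SurfaceRing.hom_ext (RingHom.ext fun c ↦ ?_) (fun i ↦ ?_)
    · exact (lift_fromSurface _ _ _ _ _).trans (SurfaceRing.lift_algebraMap _ _ _ _)
    · refine (lift_fromSurface _ _ _ _ _).trans ((SurfaceRing.lift_coord _ _ _ _).trans ?_)
      fin_cases i <;> rfl
  have h' := congrArg g h
  have hga (a) : g (fromSurface A t a) = al a := RingHom.congr_fun hg a
  have hgs : g (coord A t 3) = CoverRing.s _ τ := lift_coord _ _ _ _ 3
  rw [map_add, map_mul, hga, hga, map_zero, hgs] at h'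
  exact CoverRing.add_mul_s_eq_zero h'

theorem fromSurface_injective : Function.Injective (fromSurface A t) := by
  rw [injective_iff_map_eq_zero]
  intro a ha
  exact (add_mul_coord_eq_zero (a := a) (b := 0) (by simp [ha])).1

end HatRing

end
end ADETransform

namespace ADETransform
noncomputable section

/-! ### Cartier divisors and local freeness -/

section Cartier

variable {R : Type u} [CommRing R] {p : PrimeSpectrum R}

/-- Localizing I at f gives the extended ideal; a trivialization of it is the choice of a generator
that is not a zero divisor, namely the image of 1. -/
theorem locallyFreeOfRankAt_one_iff_cartierAt (I : Ideal R)
    (p : PrimeSpectrum R) : LocallyFreeOfRankAt R I 1 p ↔ CartierAt R I p := by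
  refine exists_congr fun f ↦ and_congr_right fun _ ↦ ?_
  let Rf := Localization.Away f
  let J := I.map (algebraMap R Rf)
  let e : LocalizedModule (Submonoid.powers f) I ≃ₗ[Rf] J :=
    (IsLocalizedModule.iso (Submonoid.powers f) (Algebra.idealMap Rf I)
      ).extendScalarsOfIsLocalization
      (Submonoid.powers f) Rf
  constructor
  · rintro ⟨e'⟩
    let e₁ : Rf ≃ₗ[Rf] J := (LinearEquiv.funUnique (Fin 1) Rf Rf).symm ≪≫ₗ e'.symm ≪≫ₗ e
    have he (r : Rf) : (e₁ r : Rf) = r * e₁ 1 := by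
      conv_lhs => rw [← mul_one r, ← smul_eq_mul, map_smul]
      rfl
    refine ⟨e₁ 1, ?_, le_antisymm (fun x hx ↦ ?_) ?_⟩
    · rw [mem_nonZeroDivisors_iff_right]
      intro r hr
      rw [← he] at hr
      exact e₁.map_eq_zero_iff.mp (Subtype.ext hr)
    · obtain ⟨r, hr⟩ := e₁.surjective ⟨x, hx⟩
      rw [Ideal.mem_span_singleton']
      exact ⟨r, by rw [← he, hr]⟩
    · rw [Ideal.span_singleton_le_iff_mem]
      exact (e₁ 1).2
  · rintro ⟨g, hg, hJ⟩
    have hinj : Function.Injective (LinearMap.toSpanSingleton Rf Rf g) := by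
      rw [← LinearMap.ker_eq_bot, LinearMap.ker_eq_bot']
      intro r hr
      exact (mem_nonZeroDivisors_iff_right.mp hg) r hr
    have hrange : (LinearMap.toSpanSingleton Rf Rf g).range = J := by
      rw [LinearMap.range_toSpanSingleton]
      exact hJ.symm
    exact ⟨e ≪≫ₗ (LinearEquiv.ofEq _ _ hrange).symm ≪≫ₗ (LinearEquiv.ofInjective _ hinj).symm ≪≫ₗ
      (LinearEquiv.funUnique (Fin 1) Rf Rf).symm⟩

theorem cartierAt_of_notMem {I : Ideal R} {f : R} (hf : f ∈ I) (hfp : f ∉ p.asIdeal) :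
    CartierAt R I p := by
  refine ⟨f, hfp, 1, one_mem _, ?_⟩
  rw [Ideal.span_singleton_one]
  exact Ideal.eq_top_of_isUnit_mem _ (Ideal.mem_map_of_mem _ hf)
    (IsLocalization.Away.algebraMap_isUnit f)

/-- Where c is invertible, a is a multiple of b, so b alone generates. -/
theorem cartierAt_span_pair [IsDomain R] {a b c d : R} (h : a * c = b * d)
    (hc : c ∉ p.asIdeal) (hb : b ≠ 0) :
    CartierAt R (Ideal.span {a, b}) p := by
  have hc0 : c ≠ 0 := fun h0 ↦ hc (h0 ▸ p.asIdeal.zero_mem)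
  have hinj : Function.Injective (algebraMap R (Localization.Away c)) :=
    IsLocalization.injective _ (powers_le_nonZeroDivisors_of_noZeroDivisors hc0)
  have : IsDomain (Localization.Away c) := IsLocalization.isDomain_localization
    (powers_le_nonZeroDivisors_of_noZeroDivisors hc0)
  refine ⟨c, hc, algebraMap R _ b, ?_, ?_⟩
  · rw [mem_nonZeroDivisors_iff_ne_zero]
    exact (map_ne_zero_iff _ hinj).mpr hb
  · rw [Ideal.map_span, Set.image_pair]
    refine le_antisymm (Ideal.span_le.mpr ?_) (Ideal.span_mono (by simp))
    rw [Set.pair_subset_iff]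
    refine ⟨?_, Ideal.mem_span_singleton_self _⟩
    rw [SetLike.mem_coe, Ideal.mem_span_singleton,
      ← (IsLocalization.Away.algebraMap_isUnit c).dvd_mul_right (b := algebraMap R _ a),
        ← map_mul, h,
      map_mul]
    exact dvd_mul_right _ _

/-- If g is a local equation, a = g a' and b = g b' where a', b' generate the unit ideal near p.
Clearing denominators in a' and b' gives α and β. -/
theorem CartierAt.exists_mul_eq_mul [IsDomain R] {a b : R} (h : CartierAt R (Ideal.span {a, b}) p) :
    ∃ α β : R, β * a = α * b ∧ (α ∈ p.asIdeal → β ∉ p.asIdeal) := by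
  obtain ⟨f, hfp, g, hg, hI⟩ := h
  have hf0 : f ≠ 0 := fun h0 ↦ hfp (h0 ▸ p.asIdeal.zero_mem)
  have hle := powers_le_nonZeroDivisors_of_noZeroDivisors hf0
  have hinj : Function.Injective (algebraMap R (Localization.Away f)) :=
      IsLocalization.injective _ hle
  rw [Ideal.map_span, Set.image_pair] at hI
  obtain ⟨a', ha'⟩ : g ∣ algebraMap R (Localization.Away f) a := by
    rw [← Ideal.mem_span_singleton, ← hI]
    exact Ideal.subset_span (by simp)
  obtain ⟨b', hb'⟩ : g ∣ algebraMap R (Localization.Away f) b := by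
    rw [← Ideal.mem_span_singleton, ← hI]
    exact Ideal.subset_span (by simp)
  have hgI : g ∈
      Ideal.span {algebraMap R (Localization.Away f) a, algebraMap R (Localization.Away f) b} :=
    hI ▸ Ideal.mem_span_singleton_self g
  obtain ⟨l, m, hlm⟩ := Ideal.mem_span_pair.mp hgI
  have h1 : l * a' + m * b' = 1 := by
    have : (l * a' + m * b' - 1) * g = 0 := by
      rw [ha', hb'] at hlm
      linear_combination hlm
    exact sub_eq_zero.mp ((mem_nonZeroDivisors_iff_right.mp hg) _ this)
  obtain ⟨n, α, hα⟩ := IsLocalization.Away.surj f a'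
  obtain ⟨k, β, hβ⟩ := IsLocalization.Away.surj f b'
  refine ⟨α * f ^ k, β * f ^ n, hinj ?_, fun hαp hβp ↦ ?_⟩
  · rw [map_mul, map_mul, map_mul, map_mul, map_pow, map_pow, ← hα, ← hβ, ha', hb']
    ring
  · have hmem : algebraMap R (Localization.Away f) (f ^ (n + k)) ∈
      p.asIdeal.map (algebraMap R (Localization.Away f)) := by
      have : algebraMap R (Localization.Away f) (f ^ (n + k)) =
          l * algebraMap R (Localization.Away f) (α * f ^ k) +
            m * algebraMap R (Localization.Away f) (β * f ^ n) := by
        rw [map_mul, map_mul, map_pow, map_pow, map_pow, ← hα, ← hβ]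
        linear_combination -algebraMap R (Localization.Away f) f ^ (n + k) * h1
      rw [this]
      exact add_mem (Ideal.mul_mem_left _ _ (Ideal.mem_map_of_mem _ hαp))
        (Ideal.mul_mem_left _ _ (Ideal.mem_map_of_mem _ hβp))
    have hdisj : Disjoint (Submonoid.powers f : Set R) p.asIdeal := by
      rw [Set.disjoint_left]
      rintro _ ⟨i, rfl⟩ hi
      exact hfp (p.2.mem_of_pow_mem i hi)
    have := IsLocalization.under_map_of_isPrime_disjoint (Submonoid.powers f)
      (Localization.Away f) p.2 hdisj
    have hmem' : f ^ (n + k) ∈ p.asIdeal := by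
      rw [← this]
      exact hmem
    exact hfp (p.2.mem_of_pow_mem _ hmem')

end Cartier

/-! ### Integrality of `Ŷ` -/

section Hat

variable {A : Type u} [CommRing A] [Algebra ℂ A] {t : A}

theorem CoverRing.isDomain_of_smooth [IsDomain A]
    (ht : (Polynomial.aeval t : Polynomial ℂ →ₐ[ℂ] A).toRingHom.Smooth) (ht₀ : ¬ IsUnit t) :
    IsDomain (CoverRing A t) :=
  CoverRing.isDomain fun _ _ h ↦ eq_zero_of_mul_sq_eq_sq ht ht₀ h

theorem isUnit_two_of_algebra_complex {B : Type*} [CommRing B] (f : ℂ →+* B) :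
    IsUnit (2 : B) := by
  have : IsUnit (2 : ℂ) := isUnit_iff_ne_zero.mpr two_ne_zero
  rw [← map_ofNat f 2]
  exact this.map f

namespace HatRing

theorem isUnit_two : IsUnit (2 : HatRing A t) :=
  isUnit_two_of_algebra_complex (algebraMap ℂ _)

open Polynomial in
-- In the coordinates u = x - y and w = x + y the equation reads z² = s² - u w, so `Ŷ` is the double
-- cover, with root z, of the plane over C with coordinates u (inner variable) and w (outer
-- variable). Since 2 is invertible, x and y are recovered from u and w, and the retraction `k`
-- shows that `g` is injective.
theorem isDomain [IsDomain (CoverRing A t)] : IsDomain (HatRing A t) := by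
  let τ : (CoverRing A t)[X][X] := C (-X) * X + C (C (CoverRing.s A t ^ 2))
  have hdeg : τ.natDegree = 1 := natDegree_linear (neg_ne_zero.mpr X_ne_zero)
  -- τ has odd degree one in the outer variable, so τ b² = a² with b ≠ 0 fails by parity of degrees.
  have : IsDomain (CoverRing _ τ) := CoverRing.isDomain fun a b h ↦ by
    by_contra hb
    have h' := congrArg natDegree h
    rw [natDegree_mul (ne_zero_of_natDegree_gt (n := 0) (by omega)) (pow_ne_zero 2 hb), hdeg,
      natDegree_pow, natDegree_pow] at h'
    omega
  let al := algebraMap (CoverRing A t)[X][X] (CoverRing _ τ)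
  let ι : A →+* CoverRing _ τ := ((al.comp C).comp C).comp (algebraMap A _)
  have hhalf : ∃ h : A, 2 * h = 1 :=
    (isUnit_two_of_algebra_complex (algebraMap ℂ A)).exists_right_inv
  obtain ⟨h, hh⟩ := hhalf
  have hι : 2 * ι h = 1 := by rw [← map_ofNat ι 2, ← map_mul, hh, map_one]
  have hs : al (C (C (CoverRing.s A t))) ^ 2 = ι t := by
    simp only [ι, RingHom.comp_apply, ← map_pow, CoverRing.s_sq]
  let g : HatRing A t →+* CoverRing _ τ := lift ι
    ![ι h * (al X + al (C X)), ι h * (al X - al (C X)), CoverRing.s _ τ,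
      al (C (C (CoverRing.s A t)))] hs (by
        simp only [Matrix.cons_val, CoverRing.s_sq]
        have : algebraMap _ (CoverRing _ τ) τ = - al (C X) * al X + ι t := by
          simp only [τ, ← hs, map_add, map_mul, map_neg, map_pow]
          rfl
        rw [this]
        linear_combination al (C X) * al X * (2 * ι h + 1) * hι)
  let k : CoverRing _ τ →+* HatRing A t := CoverRing.lift
    (eval₂RingHom (eval₂RingHom (fromCover A t).toRingHom (coord A t 0 - coord A t 1))
      (coord A t 0 + coord A t 1)) (coord A t 2) (by
        simp only [τ, coe_eval₂RingHom, eval₂_add, eval₂_mul, eval₂_C, eval₂_X, eval₂_neg]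
        have : (fromCover A t).toRingHom (CoverRing.s A t ^ 2) = coord A t 3 ^ 2 := by
          rw [map_pow]; rfl
        rw [this]
        linear_combination -relation A t)
  have hkal (q) : k (al q) = _ := CoverRing.lift_algebraMap _ _ _ q
  have hkι (a : A) : k (ι a) = algebraMap A _ a := by
    simp only [ι, RingHom.comp_apply, hkal, coe_eval₂RingHom, eval₂_C]
    exact (fromCover A t).commutes a
  have hkh : 2 * algebraMap A (HatRing A t) h = 1 := by
    rw [← map_ofNat (algebraMap A (HatRing A t)) 2, ← map_mul, hh, map_one]
  have hga (a : A) : g (algebraMap A _ a) = ι a := lift_algebraMap ..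
  have hgc (i) : g (coord A t i) = _ := lift_coord ι _ _ _ i
  have hkg : k.comp g = RingHom.id _ := by
    refine hom_ext (RingHom.ext fun a ↦ ?_) fun i ↦ ?_
    · rw [RingHom.comp_apply, RingHom.comp_apply, hga, hkι]
      rfl
    · rw [RingHom.comp_apply, hgc, RingHom.id_apply]
      fin_cases i
      · simp only [Fin.zero_eta, Matrix.cons_val, map_mul, map_add, hkι, hkal, coe_eval₂RingHom,
          eval₂_X, eval₂_C]
        linear_combination coord A t 0 * hkh
      · simp only [Fin.mk_one, Matrix.cons_val, map_mul, map_sub, hkι, hkal, coe_eval₂RingHom,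
          eval₂_X, eval₂_C]
        linear_combination coord A t 1 * hkh
      · exact CoverRing.lift_s _ _ _
      · simp only [Fin.reduceFinMk, Matrix.cons_val, hkal, coe_eval₂RingHom, eval₂_C]
        rfl
  have hinj : Function.Injective g :=
    Function.LeftInverse.injective (g := k) fun r ↦ RingHom.congr_fun hkg r
  exact hinj.isDomain g

end HatRing

end Hat

end
end ADETransform

namespace ADETransform
noncomputable section

/-! ### The families of lines in `Ŷ` -/

namespace HatRing

section Lines

variable (A : Type u) [CommRing A] (t : A)

/-- The ideal `(x ∓ y, z ∓ s)`. -/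
def lineIdeal (ε δ : ℤˣ) : Ideal (HatRing A t) :=
  Ideal.span {coord A t 0 - (ε : ℤ) * coord A t 1, coord A t 2 - (δ : ℤ) * coord A t 3}

theorem intUnits_cast_sq (B : Type*) [CommRing B] (ε : ℤˣ) : (((ε : ℤ) : B)) ^ 2 = 1 := by
  rcases Int.units_eq_one_or ε with rfl | rfl <;> simp

/-- Restriction of functions to the line `(x, y, z) = (v, ±v, ±s)` over `C`. -/
def toLine (ε δ : ℤˣ) : HatRing A t →+* Polynomial (CoverRing A t) :=
  lift (Polynomial.C.comp (algebraMap A _))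
    ![Polynomial.X, ((ε : ℤ) : Polynomial (CoverRing A t)) * Polynomial.X,
      ((δ : ℤ) : Polynomial (CoverRing A t)) * Polynomial.C (CoverRing.s A t),
      Polynomial.C (CoverRing.s A t)]
    (by simp only [Matrix.cons_val, ← map_pow, CoverRing.s_sq]; rfl)
    (by
      simp only [Matrix.cons_val, RingHom.comp_apply, ← CoverRing.s_sq, mul_pow,
        intUnits_cast_sq, map_pow]
      ring)

variable {A t} (ε δ : ℤˣ)

theorem toLine_coord (i : Fin 4) : toLine A t ε δ (coord A t i) =
    ![Polynomial.X, ((ε : ℤ) : Polynomial (CoverRing A t)) * Polynomial.X,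
      ((δ : ℤ) : Polynomial (CoverRing A t)) * Polynomial.C (CoverRing.s A t),
      Polynomial.C (CoverRing.s A t)] i := lift_coord ..

theorem toLine_fromCover (r : CoverRing A t) :
    toLine A t ε δ (fromCover A t r) = Polynomial.C r := by
  have : (toLine A t ε δ).comp (fromCover A t).toRingHom = Polynomial.C :=
    CoverRing.hom_ext (RingHom.ext fun a ↦ by
      have h : (fromCover A t) (algebraMap A _ a) = _ := (fromCover A t).commutes a
      simp only [RingHom.comp_apply, AlgHom.toRingHom_eq_coe, RingHom.coe_coe, h]
      exact lift_algebraMap ..) (toLine_coord ε δ 3)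
  exact RingHom.congr_fun this r

/-- The section of `toLine` which maps `v` to `x`. -/
def ofLine : Polynomial (CoverRing A t) →+* HatRing A t :=
  Polynomial.eval₂RingHom (fromCover A t).toRingHom (coord A t 0)

/-- Modulo the equations of the line, every function is a polynomial in x over O_C. The larger ideal
I is left free because the vertex ideal is needed as well as the ideal of the line. -/
theorem mk_ofLine_toLine {I : Ideal (HatRing A t)} (hI : lineIdeal A t ε δ ≤ I)
    (r : HatRing A t) :
    Ideal.Quotient.mk I (ofLine (toLine A t ε δ r)) = Ideal.Quotient.mk I r := by
  have hC (a) : ofLine (A := A) (t := t) (.C a) = fromCover A t a := Polynomial.eval₂_C ..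
  have hX : ofLine (A := A) (t := t) .X = coord A t 0 := Polynomial.eval₂_X ..
  have h0 : coord A t 0 - (ε : ℤ) * coord A t 1 ∈ I := hI (Ideal.subset_span (by simp))
  have h1 : coord A t 2 - (δ : ℤ) * coord A t 3 ∈ I := hI (Ideal.subset_span (by simp))
  have : ((Ideal.Quotient.mk I).comp ofLine).comp (toLine A t ε δ) = Ideal.Quotient.mk I := by
    refine hom_ext (RingHom.ext fun a ↦ ?_) fun i ↦ ?_
    · simp only [RingHom.comp_apply]
      rw [← (fromCover A t).commutes, toLine_fromCover, hC]
    · rw [RingHom.comp_apply, RingHom.comp_apply, toLine_coord, Ideal.Quotient.eq]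
      fin_cases i
      · simp only [Fin.zero_eta, Matrix.cons_val, hX, sub_self, zero_mem]
      · simp only [Fin.mk_one, Matrix.cons_val, hX, map_mul, map_intCast]
        have : (ε : ℤ) * coord A t 0 - coord A t 1
            = (ε : ℤ) * (coord A t 0 - (ε : ℤ) * coord A t 1) := by
          linear_combination coord A t 1 * intUnits_cast_sq (HatRing A t) ε
        rw [this]
        exact I.mul_mem_left _ h0
      · simp only [Fin.reduceFinMk, Matrix.cons_val, map_mul, map_intCast, hC, fromCover_s]
        rw [← neg_mem_iff, neg_sub]
        exact h1
      · simp only [Fin.reduceFinMk, Matrix.cons_val, hC, fromCover_s, sub_self, zero_mem]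
  exact RingHom.congr_fun this r

theorem ker_toLine : RingHom.ker (toLine A t ε δ) = lineIdeal A t ε δ := by
  refine le_antisymm (fun r hr ↦ ?_) (Ideal.span_le.mpr ?_)
  · rw [← Ideal.Quotient.eq_zero_iff_mem, ← mk_ofLine_toLine ε δ le_rfl,
      (RingHom.mem_ker).mp hr, map_zero, map_zero]
  · rw [Set.pair_subset_iff]
    constructor
    · rw [SetLike.mem_coe, RingHom.mem_ker, map_sub, map_mul, map_intCast, toLine_coord,
        toLine_coord]
      simp only [Matrix.cons_val]
      linear_combination - Polynomial.X * intUnits_cast_sq (Polynomial (CoverRing A t)) ε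
    · rw [SetLike.mem_coe, RingHom.mem_ker, map_sub, map_mul, map_intCast, toLine_coord,
        toLine_coord]
      simp only [Matrix.cons_val, sub_self]

theorem mem_lineIdeal {r : HatRing A t} : r ∈ lineIdeal A t ε δ ↔ toLine A t ε δ r = 0 := by
  rw [← ker_toLine, RingHom.mem_ker]

instance isPrime_lineIdeal [IsDomain (CoverRing A t)] : (lineIdeal A t ε δ).IsPrime := by
  rw [← ker_toLine]
  exact RingHom.ker_isPrime _

theorem lineIdeal_le_idealVertex : lineIdeal A t ε δ ≤ idealVertex A t := by
  have h (i) : coord A t i ∈ idealVertex A t := Ideal.subset_span ⟨i, rfl⟩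
  rw [lineIdeal, Ideal.span_le, Set.pair_subset_iff]
  exact ⟨sub_mem (h _) (Ideal.mul_mem_left _ _ (h _)),
    sub_mem (h _) (Ideal.mul_mem_left _ _ (h _))⟩

/-- The products of the equations of two different lines. -/
theorem mul_eq_neg_mul :
    (coord A t 0 - (ε : ℤ) * coord A t 1) * (coord A t 0 - ((-ε : ℤˣ) : ℤ) * coord A t 1) =
      (coord A t 2 - (δ : ℤ) * coord A t 3) * -(coord A t 2 - ((-δ : ℤˣ) : ℤ) * coord A t 3) := by
  push_cast
  linear_combination - relation A t - coord A t 1 ^ 2 * intUnits_cast_sq (HatRing A t) ε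
    - coord A t 3 ^ 2 * intUnits_cast_sq (HatRing A t) δ

variable [Algebra ℂ A] [IsDomain (CoverRing A t)]

theorem sub_notMem_lineIdeal_neg_left :
    coord A t 0 - (ε : ℤ) * coord A t 1 ∉ lineIdeal A t (-ε) δ := by
  rw [mem_lineIdeal, map_sub, map_mul, map_intCast, toLine_coord, toLine_coord]
  simp only [Matrix.cons_val]
  push_cast
  have h2 : (2 : Polynomial (CoverRing A t)) ≠ 0 :=
    (isUnit_two_of_algebra_complex (Polynomial.C.comp ((algebraMap A _).comp
      (algebraMap ℂ A)))).ne_zero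
  have : (Polynomial.X : Polynomial (CoverRing A t)) - ((ε : ℤ) : Polynomial (CoverRing A t)) *
      (-((ε : ℤ) : Polynomial (CoverRing A t)) * Polynomial.X)
      = 2 * Polynomial.X := by
    linear_combination Polynomial.X * intUnits_cast_sq (Polynomial (CoverRing A t)) ε
  rw [this]
  exact mul_ne_zero h2 Polynomial.X_ne_zero

theorem sub_notMem_lineIdeal_neg_right :
    coord A t 2 - (δ : ℤ) * coord A t 3 ∉ lineIdeal A t ε (-δ) := by
  have : Nontrivial A := (algebraMap A (CoverRing A t)).domain_nontrivial
  rw [mem_lineIdeal, map_sub, map_mul, map_intCast, toLine_coord, toLine_coord]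
  simp only [Matrix.cons_val]
  push_cast
  have h2 : (2 : Polynomial (CoverRing A t)) ≠ 0 :=
    (isUnit_two_of_algebra_complex (Polynomial.C.comp ((algebraMap A _).comp
      (algebraMap ℂ A)))).ne_zero
  have hδ : ((δ : ℤ) : Polynomial (CoverRing A t)) ≠ 0 := by
    intro h
    have := intUnits_cast_sq (Polynomial (CoverRing A t)) δ
    rw [h] at this
    simp at this
  have (x : Polynomial (CoverRing A t)) : -((δ : ℤ) : Polynomial (CoverRing A t)) * x - (δ : ℤ) * x
      = -(2 * ((δ : ℤ) * x)) := by ring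
  rw [this, neg_eq_zero]
  exact mul_ne_zero h2 (mul_ne_zero hδ (Polynomial.C_ne_zero.mpr CoverRing.s_ne_zero))

theorem sub_ne_zero_left : coord A t 0 - (ε : ℤ) * coord A t 1 ≠ 0 := fun h ↦
  sub_notMem_lineIdeal_neg_left (A := A) (t := t) ε 1 (h ▸ zero_mem _)

theorem sub_ne_zero_right : coord A t 2 - (δ : ℤ) * coord A t 3 ≠ 0 := fun h ↦
  sub_notMem_lineIdeal_neg_right (A := A) (t := t) 1 δ (h ▸ zero_mem _)

/-- Write a, b for the two generators. Being Cartier at p yields β a = α b with α, β not both in p.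
The line (ε, -δ) is prime and contains a but not b, so it contains α; likewise (-ε, δ) contains β.
Both lines lie in the vertex ideal, hence p does not contain it. -/
theorem cartierAt_lineIdeal_iff (p : PrimeSpectrum (HatRing A t)) :
    CartierAt (HatRing A t) (lineIdeal A t ε δ) p ↔ ¬ idealVertex A t ≤ p.asIdeal := by
  have : IsDomain (HatRing A t) := isDomain
  constructor
  · intro h hp
    obtain ⟨α, β, hαβ, hp'⟩ := h.exists_mul_eq_mul
    refine hp' (hp (lineIdeal_le_idealVertex ε (-δ) ?_)) (hp (lineIdeal_le_idealVertex (-ε) δ ?_))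
    · have hmem : α * (coord A t 2 - (δ : ℤ) * coord A t 3) ∈ lineIdeal A t ε (-δ) := by
        rw [← hαβ]
        exact Ideal.mul_mem_left _ _ (Ideal.subset_span (by simp))
      exact ((isPrime_lineIdeal ε (-δ)).mem_or_mem hmem).resolve_right
        (sub_notMem_lineIdeal_neg_right ε δ)
    · have hmem : β * (coord A t 0 - (ε : ℤ) * coord A t 1) ∈ lineIdeal A t (-ε) δ := by
        rw [hαβ]
        exact Ideal.mul_mem_left _ _ (Ideal.subset_span (by simp))
      exact ((isPrime_lineIdeal (-ε) δ).mem_or_mem hmem).resolve_right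
        (sub_notMem_lineIdeal_neg_left ε δ)
  · intro hp
    -- If any of the four linear factors is invertible at p, the ideal is trivial or principal
    -- there. So all four lie in p, and as 2 is invertible, so do x, y, z and s.
    by_contra hcart
    apply hp
    have ha : coord A t 0 - (ε : ℤ) * coord A t 1 ∈ p.asIdeal := by
      by_contra h
      exact hcart (cartierAt_of_notMem (Ideal.subset_span (by simp)) h)
    have hb : coord A t 2 - (δ : ℤ) * coord A t 3 ∈ p.asIdeal := by
      by_contra h
      exact hcart (cartierAt_of_notMem (Ideal.subset_span (by simp)) h)
    have hc : coord A t 0 - ((-ε : ℤˣ) : ℤ) * coord A t 1 ∈ p.asIdeal := by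
      by_contra h
      exact hcart (cartierAt_span_pair (mul_eq_neg_mul ε δ) h (sub_ne_zero_right δ))
    have hd : coord A t 2 - ((-δ : ℤˣ) : ℤ) * coord A t 3 ∈ p.asIdeal := by
      by_contra h
      refine hcart ?_
      rw [lineIdeal, Set.pair_comm]
      refine cartierAt_span_pair (d := -(coord A t 0 - ((-ε : ℤˣ) : ℤ) * coord A t 1))
        ?_ h (sub_ne_zero_left ε)
      linear_combination mul_eq_neg_mul (A := A) (t := t) ε δ
    have key (x y : HatRing A t) (ε : ℤˣ) (h1 : x - (ε : ℤ) * y ∈ p.asIdeal)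
        (h2 : x - ((-ε : ℤˣ) : ℤ) * y ∈ p.asIdeal) : x ∈ p.asIdeal ∧ y ∈ p.asIdeal := by
      have hx : x ∈ p.asIdeal := by
        have := add_mem h1 h2
        rw [show x - (ε : ℤ) * y + (x - ((-ε : ℤˣ) : ℤ) * y) = 2 * x by push_cast; ring] at this
        exact (p.2.mem_or_mem this).resolve_left
          fun h ↦ p.2.ne_top (Ideal.eq_top_of_isUnit_mem _ h isUnit_two)
      refine ⟨hx, ?_⟩
      have := p.asIdeal.mul_mem_left ((ε : ℤ) : HatRing A t) (sub_mem hx h1)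
      rwa [show ((ε : ℤ) : HatRing A t) * (x - (x - (ε : ℤ) * y)) = y by
        linear_combination y * intUnits_cast_sq (HatRing A t) ε] at this
    obtain ⟨hx, hy⟩ := key _ _ ε ha hc
    obtain ⟨hz, hs⟩ := key _ _ δ hb hd
    rw [idealVertex, Ideal.span_le]
    rintro _ ⟨i, rfl⟩
    fin_cases i
    exacts [hx, hy, hz, hs]

end Lines

end HatRing

/-! ### The divisor `D` -/

section Divisor

variable {A : Type u} [CommRing A] {t : A}

/-- The preimage of the diagonal in `R̂` is the graph of R → C, a copy of R: modulo the extended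
ideal 1 ⊗ d ≡ d ⊗ 1, so every x is congruent to θ(x) ⊗ 1. -/
theorem map_idealDiagonal_eq_ker :
    (idealDiagonal A t).map (pullbackToHatCylinder A t) =
      RingHom.ker (Algebra.TensorProduct.productMap (AlgHom.id A (CylinderRing A t))
        (IsScalarTower.toAlgHom A (CoverRing A t) (CylinderRing A t))) := by
  set θ := Algebra.TensorProduct.productMap (AlgHom.id A (CylinderRing A t))
        (IsScalarTower.toAlgHom A (CoverRing A t) (CylinderRing A t))
  refine le_antisymm ?_ fun x hx ↦ ?_
  · rw [Ideal.map_le_iff_le_comap]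
    intro r hr
    rw [Ideal.mem_comap, RingHom.mem_ker]
    have : θ.comp (pullbackToHatCylinder A t) =
        (IsScalarTower.toAlgHom A (CoverRing A t) (CylinderRing A t)).comp
          (Algebra.TensorProduct.lmul' A) := by
      ext <;> simp [θ, pullbackToHatCylinder]
    have h := DFunLike.congr_fun this r
    rw [AlgHom.comp_apply, AlgHom.comp_apply, (RingHom.mem_ker).mp hr, map_zero] at h
    exact h
  · have key : x - θ x ⊗ₜ 1 ∈ (idealDiagonal A t).map (pullbackToHatCylinder A t) := by
      clear hx
      induction x using TensorProduct.induction_on with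
      | zero => simp
      | add x y hx hy =>
        have := add_mem hx hy
        rwa [show x - θ x ⊗ₜ 1 + (y - θ y ⊗ₜ 1) = x + y - θ (x + y) ⊗ₜ 1 by
          rw [map_add, TensorProduct.add_tmul]; ring] at this
      | tmul c d =>
        have hmem : (1 ⊗ₜ d - d ⊗ₜ 1 : CoverRing A t ⊗[A] CoverRing A t) ∈ idealDiagonal A t := by
          rw [idealDiagonal, RingHom.mem_ker]
          simp
        have := Ideal.mul_mem_left _ (c ⊗ₜ[A] (1 : CoverRing A t))
          (Ideal.mem_map_of_mem (pullbackToHatCylinder A t) hmem)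
        have he : (c ⊗ₜ[A] (1 : CoverRing A t)) *
            pullbackToHatCylinder A t (1 ⊗ₜ d - d ⊗ₜ 1) = c ⊗ₜ d - θ (c ⊗ₜ d) ⊗ₜ 1 := by
          rw [map_sub, mul_sub]
          simp [θ, pullbackToHatCylinder]
        rwa [he] at this
    rwa [(RingHom.mem_ker).mp hx, TensorProduct.zero_tmul, sub_zero] at key

/-- Restricting a function to `R̂` and then to the graph of R → C substitutes (x, y, z, s) = (v, v,
s, s), which is `toLine` with both signs positive. -/
theorem idealD_eq_lineIdeal : idealD A t = HatRing.lineIdeal A t 1 1 := by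
  rw [idealD, map_idealDiagonal_eq_ker, ← HatRing.ker_toLine]
  set θ := Algebra.TensorProduct.productMap (AlgHom.id A (CylinderRing A t))
        (IsScalarTower.toAlgHom A (CoverRing A t) (CylinderRing A t))
  have hS (x) : θ (restrictToHatCylinder A t (HatRing.fromSurface A t x)) =
      restrictToCylinder A t x := by
    have : restrictToHatCylinder A t (HatRing.fromSurface A t x) =
        restrictToCylinder A t x ⊗ₜ 1 := Algebra.TensorProduct.map_tmul _ _ x 1
    rw [this]
    simp [θ]
  have hr (i) : restrictToCylinder A t (SurfaceRing.coord A t i) =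
      ![Polynomial.X, Polynomial.X, Polynomial.C (CoverRing.s A t)] i :=
    MvPolynomial.aeval_X _ i
  have h : (θ.comp (restrictToHatCylinder A t)).toRingHom =
      HatRing.toLine A t 1 1 := by
    refine HatRing.hom_ext (RingHom.ext fun a ↦ ?_) fun i ↦ ?_
    · simp only [RingHom.comp_apply, AlgHom.toRingHom_eq_coe, RingHom.coe_coe, AlgHom.commutes]
      exact (HatRing.lift_algebraMap ..).symm
    · rw [HatRing.toLine_coord]
      simp only [AlgHom.toRingHom_eq_coe, RingHom.coe_coe, AlgHom.comp_apply]
      fin_cases i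
      · exact (hS _).trans (hr 0)
      · exact (hS _).trans ((hr 1).trans (by simp))
      · exact (hS _).trans ((hr 2).trans (by simp))
      · have : restrictToHatCylinder A t (HatRing.coord A t 3) =
          1 ⊗ₜ CoverRing.s A t := (Algebra.TensorProduct.map_tmul _ _ 1 _).trans (by simp)
        simp only [Fin.reduceFinMk, this]
        simp [θ]
  rw [← h]
  rfl

end Divisor

end
end ADETransform

namespace ADETransform
noncomputable section

/-! ### Ideal quotients, rank one, and ideals in double covers -/

section General

variable {R : Type u} [CommRing R]

/-- `O(D)` for the divisor `D` with equations `a, b` is isomorphic to the ideal `(a) : (b)`. -/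
theorem exists_linearEquiv_divisorialSheaf [IsDomain R] {a b : R} (ha : a ≠ 0) {J : Ideal R}
    (hJ : ∀ r, r ∈ J ↔ a ∣ r * b) :
    Nonempty (J ≃ₗ[R] divisorialSheaf R (Ideal.span {a, b})) := by
  have ha' : algebraMap R (FractionRing R) a ≠ 0 :=
      (map_ne_zero_iff _ (IsFractionRing.injective R (FractionRing R))).mpr ha
  let f : J →ₗ[R] FractionRing R := (LinearMap.mulRight R (algebraMap R (FractionRing R) a)⁻¹) ∘ₗ
    (Algebra.linearMap R (FractionRing R)) ∘ₗ J.subtype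
  have hf (r : J) : f r =
      algebraMap R (FractionRing R) r * (algebraMap R (FractionRing R) a)⁻¹ := rfl
  have hmem (r : J) : f r ∈ divisorialSheaf R (Ideal.span {a, b}) := by
    intro g hg
    obtain ⟨l, m, rfl⟩ := Ideal.mem_span_pair.mp hg
    obtain ⟨c, hc⟩ := (hJ r).mp r.2
    refine ⟨l * r + m * c, ?_⟩
    have hc' := congrArg (algebraMap R (FractionRing R)) hc
    rw [map_mul, map_mul] at hc'
    change _ * f r = _
    rw [hf]
    simp only [map_add, map_mul]
    field_simp
    linear_combination algebraMap R (FractionRing R) m * hc'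
  refine ⟨LinearEquiv.ofBijective (f.codRestrict _ hmem) ⟨fun r r' h ↦ ?_, fun ⟨x, hx⟩ ↦ ?_⟩⟩
  · have h' : f r = f r' := congrArg Subtype.val h
    rw [hf, hf] at h'
    exact Subtype.ext
        (IsFractionRing.injective R (FractionRing R) (mul_right_cancel₀ (inv_ne_zero ha') h'))
  · obtain ⟨r, hr⟩ := hx a (Ideal.subset_span (by simp))
    obtain ⟨c, hc⟩ := hx b (Ideal.subset_span (by simp))
    have hrJ : r ∈ J := by
      rw [hJ]
      refine ⟨c, IsFractionRing.injective R (FractionRing R) ?_⟩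
      rw [map_mul, map_mul]
      linear_combination algebraMap R (FractionRing R) a * hc - algebraMap R (FractionRing R) b * hr
    refine ⟨⟨r, hrJ⟩, Subtype.ext ?_⟩
    change f ⟨r, hrJ⟩ = x
    rw [hf]
    change algebraMap R (FractionRing R) r * _ = x
    rw [← hr]
    field_simp

theorem finrank_ideal_eq_one [IsDomain R] {J : Ideal R} (hJ : J ≠ ⊥) (hfg : J.FG) :
    Module.finrank R J = 1 := by
  have : Module.Finite R J := Module.Finite.iff_fg.mpr hfg
  obtain ⟨j, hj, hj0⟩ := Submodule.exists_mem_ne_zero_of_ne_bot hJ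
  refine le_antisymm ?_ ?_
  · rw [← Module.finrank_self R]
    exact LinearMap.finrank_le_finrank_of_injective J.injective_subtype
  · rw [← Module.finrank_self R]
    refine LinearMap.finrank_le_finrank_of_injective
      (f := LinearMap.toSpanSingleton R J ⟨j, hj⟩) fun r r' h ↦ ?_
    exact mul_right_cancel₀ hj0 (congrArg Subtype.val h)

/-- The span of u and z + σ over S is already an ideal, because σ u = u (z + σ) - z u and σ (z + σ)
= z (z + σ) + w u. Independence is read off from the coefficient of σ. -/
theorem exists_basis_span_pair {S : Type v} [CommRing S] [Algebra S R] {σ : R}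
    (hspan : ∀ r : R, ∃ a b : S, r = algebraMap S R a + algebraMap S R b * σ)
    (hind : ∀ a b : S, algebraMap S R a + algebraMap S R b * σ = 0 → a = 0 ∧ b = 0)
    {u z w : S} (hrel : σ ^ 2 = algebraMap S R (z ^ 2 + u * w)) (hu : ∀ a, a * u = 0 → a = 0)
    (I : Ideal R) (hI : I = Ideal.span {algebraMap S R u, algebraMap S R z + σ}) :
    ∃ b : Module.Basis (Fin 2) S I,
      (b 0 : R) = algebraMap S R u ∧ (b 1 : R) = algebraMap S R z + σ := by
  have h0 : algebraMap S R u ∈ I := hI ▸ Ideal.subset_span (by simp)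
  have h1 : algebraMap S R z + σ ∈ I := hI ▸ Ideal.subset_span (by simp)
  let e : Fin 2 → I := ![⟨_, h0⟩, ⟨_, h1⟩]
  have hli : LinearIndependent S e := by
    rw [LinearIndependent.pair_iff]
    intro a b h
    have h' := congrArg Subtype.val h
    simp only [Submodule.coe_add, Submodule.coe_smul_of_tower, Submodule.coe_zero,
      Algebra.smul_def] at h'
    obtain ⟨h₁, rfl⟩ := hind (a * u + b * z) b (by
      simp only [map_add, map_mul]
      linear_combination h')
    exact ⟨hu a (by simpa using h₁), rfl⟩
  have hsp : ⊤ ≤ Submodule.span S (Set.range e) := by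
    rintro ⟨x, hx⟩ -
    have hx' := hx
    rw [hI] at hx'
    obtain ⟨p, q, hpq⟩ := Ideal.mem_span_pair.mp hx'
    obtain ⟨a, b, rfl⟩ := hspan p
    obtain ⟨c, d, rfl⟩ := hspan q
    -- Expansion of (a + b σ) u + (c + d σ)(z + σ) by the two formulas for multiplication by σ.
    have : (⟨x, hx⟩ : I) = (a - b * z + d * w) • e 0 + (b * u + c + d * z) • e 1 := by
      refine Subtype.ext ?_
      simp only [Submodule.coe_add, Submodule.coe_smul_of_tower, Algebra.smul_def, e,
        Matrix.cons_val_zero, Matrix.cons_val_one, ← hpq, map_add, map_sub, map_mul]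
      simp only [map_add, map_mul, map_pow] at hrel
      linear_combination algebraMap S R d * hrel
    rw [this]
    exact add_mem (Submodule.smul_mem _ _ (Submodule.subset_span ⟨0, rfl⟩))
      (Submodule.smul_mem _ _ (Submodule.subset_span ⟨1, rfl⟩))
  refine ⟨Module.Basis.mk hli hsp, ?_, ?_⟩
  · rw [Module.Basis.mk_apply]
    rfl
  · rw [Module.Basis.mk_apply]
    rfl

/-- Being locally free only depends on the isomorphism class. -/
theorem LocallyFreeOfRankAt.congr {M : Type v} [AddCommGroup M] [Module R M] {N : Type w}
    [AddCommGroup N] [Module R N] (e : M ≃ₗ[R] N) {n : ℕ} {p : PrimeSpectrum R}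
    (h : LocallyFreeOfRankAt R M n p) : LocallyFreeOfRankAt R N n p := by
  obtain ⟨f, hf, ⟨e'⟩⟩ := h
  refine ⟨f, hf, ⟨?_ ≪≫ₗ e'⟩⟩
  exact (IsLocalizedModule.mapEquiv (Submonoid.powers f)
    (LocalizedModule.mkLinearMap (Submonoid.powers f) N)
    (LocalizedModule.mkLinearMap (Submonoid.powers f) M) (Localization (Submonoid.powers f)) e.symm)

end General

theorem Conifold.exists_basis_idealDPrime :
    ∃ b : Module.Basis (Fin 2) (MvPolynomial (Fin 3) ℂ) Conifold.idealDPrime,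
      (b 0 : Conifold) = Conifold.coord 0 - Conifold.coord 1 ∧
      (b 1 : Conifold) = Conifold.coord 2 + Conifold.coord 3 := by
  have hX (j : Fin 3) : algebraMap (MvPolynomial (Fin 3) ℂ) Conifold (.X j) =
      ![coord 0, coord 1, coord 2] j := by
    rw [algebraMap_eq_fromXYZ, fromXYZ, MvPolynomial.aeval_X]
  have h0 := hX 0
  have h1 := hX 1
  have h2 := hX 2
  simp only [Matrix.cons_val] at h0 h1 h2
  obtain ⟨b, hb0, hb1⟩ := exists_basis_span_pair (R := Conifold)
    (S := MvPolynomial (Fin 3) ℂ) (σ := coord 3)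
    exists_eq_add_mul_coord (fun _ _ ↦ add_mul_coord_eq_zero)
    (u := .X 0 - .X 1) (z := .X 2) (w := .X 0 + .X 1)
    (by
      simp only [map_add, map_mul, map_sub, map_pow, h0, h1, h2]
      linear_combination relation)
    (fun a ha ↦ (mul_eq_zero.mp ha).resolve_right
      (sub_ne_zero.mpr fun h ↦ absurd (MvPolynomial.X_injective h) (by decide)))
    idealDPrime (by rw [map_sub, h0, h1, h2]; rfl)
  refine ⟨b, ?_, ?_⟩
  · rw [hb0, map_sub, h0, h1]
  · rw [hb1, h2]

/-! ### The sheaf O(D) as the ideal of the complementary line -/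

section Sheaf

variable {A : Type u} [CommRing A] {t : A}

/-- An isomorphism of sheaves on `Ŷ` is an isomorphism of their pushforwards. -/
def Pushforward.congr {N : Type v} [AddCommGroup N] [Module (HatRing A t) N]
    {N' : Type w} [AddCommGroup N'] [Module (HatRing A t) N'] (e : N ≃ₗ[HatRing A t] N') :
    Pushforward A t N ≃ₗ[SurfaceRing A t] Pushforward A t N' :=
  { e.toAddEquiv with map_smul' := fun c x ↦ e.map_smul (algebraMap _ (HatRing A t) c) x }

/-- The pushforward of an ideal sheaf. -/
def Pushforward.idealEquiv (J : Ideal (HatRing A t)) :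
    J ≃ₗ[SurfaceRing A t] Pushforward A t J :=
  { AddEquiv.refl J with map_smul' := fun c x ↦ Subtype.ext (Algebra.smul_def c (x : HatRing A t)) }

theorem HatRing.lineIdeal_one_one : HatRing.lineIdeal A t 1 1 =
    Ideal.span {coord A t 0 - coord A t 1, coord A t 2 - coord A t 3} := by
  simp [lineIdeal]

theorem HatRing.lineIdeal_one_neg_one : HatRing.lineIdeal A t 1 (-1) =
    Ideal.span {coord A t 0 - coord A t 1, coord A t 2 + coord A t 3} := by
  simp [lineIdeal]

theorem HatRing.fg_lineIdeal (ε δ : ℤˣ) : (lineIdeal A t ε δ).FG :=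
  Submodule.fg_span (Set.toFinite _)

variable [Algebra ℂ A] [IsDomain (CoverRing A t)]

/-- (z + s)(z - s) is a multiple of x - y, which gives one direction. Conversely the ideal of D' is
prime and contains x - y but not z - s. -/
theorem HatRing.mem_lineIdeal_one_neg_one_iff (r : HatRing A t) :
    r ∈ lineIdeal A t 1 (-1) ↔
      coord A t 0 - coord A t 1 ∣ r * (coord A t 2 - coord A t 3) := by
  have h := sub_notMem_lineIdeal_neg_right (A := A) (t := t) 1 1
  simp only [Units.val_one, Int.cast_one, one_mul] at h
  constructor
  · rw [lineIdeal_one_neg_one, Ideal.mem_span_pair]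
    rintro ⟨a, b, rfl⟩
    refine ⟨a * (coord A t 2 - coord A t 3) - b * (coord A t 0 + coord A t 1), ?_⟩
    linear_combination -b * relation A t
  · rintro ⟨c, hc⟩
    have hmem : r * (coord A t 2 - coord A t 3) ∈ lineIdeal A t 1 (-1) := by
      rw [hc, lineIdeal_one_neg_one]
      exact Ideal.mul_mem_right _ _ (Ideal.subset_span (by simp))
    exact ((isPrime_lineIdeal 1 (-1)).mem_or_mem hmem).resolve_right h

theorem HatRing.coord_zero_sub_coord_one_ne_zero : coord A t 0 - coord A t 1 ≠ 0 := by
  simpa using sub_ne_zero_left (A := A) (t := t) 1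

theorem exists_linearEquiv_sheafD :
    Nonempty (HatRing.lineIdeal A t 1 (-1) ≃ₗ[HatRing A t] sheafD A t) := by
  have : IsDomain (HatRing A t) := HatRing.isDomain
  rw [sheafD, idealD_eq_lineIdeal, HatRing.lineIdeal_one_one]
  exact exists_linearEquiv_divisorialSheaf HatRing.coord_zero_sub_coord_one_ne_zero
    HatRing.mem_lineIdeal_one_neg_one_iff

theorem HatRing.lineIdeal_ne_bot (ε δ : ℤˣ) : lineIdeal A t ε δ ≠ ⊥ := fun h ↦
  sub_ne_zero_left (A := A) (t := t) ε <| by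
    rw [← Ideal.mem_bot, ← h]
    exact Ideal.subset_span (by simp)

theorem finite_sheafD : Module.Finite (HatRing A t) (sheafD A t) := by
  obtain ⟨e⟩ := exists_linearEquiv_sheafD (A := A) (t := t)
  have : Module.Finite (HatRing A t) (HatRing.lineIdeal A t 1 (-1)) :=
    Module.Finite.iff_fg.mpr (HatRing.fg_lineIdeal _ _)
  exact Module.Finite.equiv e

theorem finrank_sheafD : Module.finrank (HatRing A t) (sheafD A t) = 1 := by
  have : IsDomain (HatRing A t) := HatRing.isDomain
  obtain ⟨e⟩ := exists_linearEquiv_sheafD (A := A) (t := t)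
  rw [← e.finrank_eq]
  exact finrank_ideal_eq_one (HatRing.lineIdeal_ne_bot _ _) (HatRing.fg_lineIdeal _ _)

theorem locallyFreeOfRankAt_sheafD_iff (p : PrimeSpectrum (HatRing A t)) :
    LocallyFreeOfRankAt (HatRing A t) (sheafD A t) 1 p ↔
      ¬ HatRing.idealVertex A t ≤ p.asIdeal := by
  obtain ⟨e⟩ := exists_linearEquiv_sheafD (A := A) (t := t)
  rw [← HatRing.cartierAt_lineIdeal_iff 1 (-1), ← locallyFreeOfRankAt_one_iff_cartierAt]
  exact ⟨fun h ↦ h.congr e.symm, fun h ↦ h.congr e⟩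

theorem exists_basis_lineIdeal :
    Nonempty (Module.Basis (Fin 2) (SurfaceRing A t) (HatRing.lineIdeal A t 1 (-1))) := by
  have : IsDomain (HatRing A t) := HatRing.isDomain
  have hc (i : Fin 3) : algebraMap (SurfaceRing A t) (HatRing A t) (SurfaceRing.coord A t i) =
    HatRing.coord A t i.castSucc := HatRing.fromSurface_coord i
  have h0 := hc 0
  have h1 := hc 1
  have h2 := hc 2
  simp only [Fin.castSucc_zero, Fin.castSucc_one, Fin.reduceCastSucc] at h0 h1 h2
  have hinj : Function.Injective (algebraMap (SurfaceRing A t) (HatRing A t)) :=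
    HatRing.fromSurface_injective
  obtain ⟨b, -, -⟩ := exists_basis_span_pair (R := HatRing A t)
    (S := SurfaceRing A t) (σ := HatRing.coord A t 3)
    HatRing.exists_eq_add_mul_coord (fun _ _ ↦ HatRing.add_mul_coord_eq_zero)
    (u := SurfaceRing.coord A t 0 - SurfaceRing.coord A t 1) (z := SurfaceRing.coord A t 2)
    (w := SurfaceRing.coord A t 0 + SurfaceRing.coord A t 1)
    (by
      simp only [map_add, map_mul, map_sub, map_pow, h0, h1, h2]
      linear_combination HatRing.relation A t)
    (fun a ha ↦ by
      have := congrArg (algebraMap (SurfaceRing A t) (HatRing A t)) ha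
      rw [map_mul, map_zero, map_sub, h0, h1] at this
      exact (map_eq_zero_iff _ hinj).mp ((mul_eq_zero.mp this).resolve_right
        HatRing.coord_zero_sub_coord_one_ne_zero))
    (HatRing.lineIdeal A t 1 (-1))
    (by rw [map_sub, h0, h1, h2, HatRing.lineIdeal_one_neg_one])
  exact ⟨b⟩

theorem exists_linearEquiv_pushforward_sheafD :
    Nonempty (Pushforward A t (sheafD A t) ≃ₗ[SurfaceRing A t]
      SurfaceRing A t × SurfaceRing A t) := by
  obtain ⟨e⟩ := exists_linearEquiv_sheafD (A := A) (t := t)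
  obtain ⟨b⟩ := exists_basis_lineIdeal (A := A) (t := t)
  exact ⟨(Pushforward.congr e).symm ≪≫ₗ (Pushforward.idealEquiv _).symm ≪≫ₗ b.equivFun ≪≫ₗ
    LinearEquiv.finTwoArrow _ _⟩

end Sheaf

/-! ### Heights -/

namespace HatRing

variable {A : Type u} [CommRing A] {t : A}

theorem isNoetherianRing [IsNoetherianRing A] : IsNoetherianRing (HatRing A t) := by
  have h1 : Algebra.FiniteType A (SurfaceRing A t) :=
    .of_surjective (Ideal.Quotient.mkₐ A (Ideal.span {(MvPolynomial.C t - MvPolynomial.X 0 ^ 2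
      + MvPolynomial.X 1 ^ 2 - MvPolynomial.X 2 ^ 2 : MvPolynomial (Fin 3) A)}))
      Ideal.Quotient.mk_surjective
  have h2 : Algebra.FiniteType A (CoverRing A t) :=
    .of_surjective (Ideal.Quotient.mkₐ A
      (Ideal.span {(Polynomial.C t - Polynomial.X ^ 2 : Polynomial A)}))
      Ideal.Quotient.mk_surjective
  have h3 : Algebra.FiniteType A (SurfaceRing A t ⊗[A] CoverRing A t) :=
    .trans h1 inferInstance
  exact Algebra.FiniteType.isNoetherianRing A (SurfaceRing A t ⊗[A] CoverRing A t)

/-- Over {t = 0}, setting x = y = z = s = 0 defines a section of `Ŷ`; A/(t) is nonzero because t is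
not a unit. -/
theorem idealVertex_ne_top (ht₀ : ¬ IsUnit t) : idealVertex A t ≠ ⊤ := by
  let f : HatRing A t →+* A ⧸ Ideal.span {t} := lift (Ideal.Quotient.mk _) 0
    (by simp [Ideal.Quotient.eq_zero_iff_mem.mpr (Ideal.mem_span_singleton_self t)])
    (by simp [Ideal.Quotient.eq_zero_iff_mem.mpr (Ideal.mem_span_singleton_self t)])
  have : Nontrivial (A ⧸ Ideal.span {t}) := Ideal.Quotient.nontrivial_iff.mpr
    (by rwa [Ne, Ideal.span_singleton_eq_top])
  have hle : idealVertex A t ≤ RingHom.ker f := by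
    rw [idealVertex, Ideal.span_le]
    rintro _ ⟨i, rfl⟩
    exact lift_coord ..
  exact fun h ↦ RingHom.ker_ne_top f (top_le_iff.mp (h ▸ hle))

variable [Algebra ℂ A] [IsDomain (CoverRing A t)]

/-- D is minimal over x - y: a prime below it that contains x - y contains (z - s)(z + s), and z + s
does not vanish on D. Krull's theorem gives height at most one; the ideal is nonzero in a domain. -/
theorem height_lineIdeal_one_one [IsNoetherianRing A] : (lineIdeal A t 1 1).height = 1 := by
  have : IsDomain (HatRing A t) := isDomain
  have : IsNoetherianRing (HatRing A t) := isNoetherianRing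
  refine le_antisymm ?_ ?_
  · have : (Ideal.span {coord A t 0 - coord A t 1}).IsPrincipal := ⟨_, rfl⟩
    refine Ideal.height_le_one_of_isPrincipal_of_mem_minimalPrimes
      (Ideal.span {coord A t 0 - coord A t 1}) _ ⟨⟨inferInstance, ?_⟩, ?_⟩
    · rw [lineIdeal_one_one]
      exact Ideal.span_mono (by simp)
    · rintro q ⟨hq, hle⟩ hqD
      have h0 : coord A t 0 - coord A t 1 ∈ q := hle (Ideal.mem_span_singleton_self _)
      have hprod : (coord A t 2 - coord A t 3) * (coord A t 2 + coord A t 3) ∈ q := by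
        have : (coord A t 2 - coord A t 3) * (coord A t 2 + coord A t 3) =
            (coord A t 0 - coord A t 1) * -(coord A t 0 + coord A t 1) := by
          linear_combination -relation A t
        rw [this]
        exact q.mul_mem_right _ h0
      have hnot := sub_notMem_lineIdeal_neg_right (A := A) (t := t) 1 (-1)
      simp only [Units.val_neg, Units.val_one, Int.cast_neg, Int.cast_one, neg_mul, one_mul,
        sub_neg_eq_add, neg_neg] at hnot
      have h1 := (hq.mem_or_mem hprod).resolve_right fun h ↦ hnot (hqD h)
      rw [lineIdeal_one_one, Ideal.span_le, Set.pair_subset_iff]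
      exact ⟨h0, h1⟩
  · have := Ideal.height_add_one_le_of_lt_of_isPrime
      (bot_lt_iff_ne_bot.mpr (lineIdeal_ne_bot (A := A) (t := t) 1 1))
    exact le_trans (by simp) this

/-- As s² = x² - y² + z², the components of the vertex locus are minimal over the three functions x,
y, z, so the height is at most three. For the other bound, the ideal of D, of height one, is
followed by (x, y, z - s) and p. -/
theorem height_eq_three [IsNoetherianRing A] {p : Ideal (HatRing A t)}
    (hp : p ∈ (idealVertex A t).minimalPrimes) : p.height = 3 := by
  have : IsDomain (HatRing A t) := isDomain
  have : IsNoetherianRing (HatRing A t) := isNoetherianRing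
  have : Nontrivial A := (algebraMap A (CoverRing A t)).domain_nontrivial
  have hpp : p.IsPrime := hp.1.1
  have hv (i) : coord A t i ∈ idealVertex A t := Ideal.subset_span ⟨i, rfl⟩
  refine le_antisymm ?_ ?_
  · have hmin : p ∈ (Ideal.span {coord A t 0, coord A t 1, coord A t 2}).minimalPrimes := by
      refine ⟨⟨hpp, ?_⟩, ?_⟩
      · refine le_trans (Ideal.span_le.mpr ?_) hp.1.2
        rintro _ (rfl | rfl | rfl) <;> exact hv _
      · rintro q ⟨hq, hle⟩ hqp
        have hm (i : Fin 3) : coord A t i.castSucc ∈ q :=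
          hle (Ideal.subset_span (by fin_cases i <;> simp))
        refine hp.2 ⟨hq, ?_⟩ hqp
        rw [idealVertex, Ideal.span_le]
        rintro _ ⟨i, rfl⟩
        refine Fin.lastCases ?_ (fun i ↦ hm i) i
        have hs : coord A t 3 ^ 2 ∈ q := by
          have : coord A t 3 ^ 2 = coord A t 0 * coord A t 0 - coord A t 1 * coord A t 1 +
              coord A t 2 * coord A t 2 := by
            linear_combination relation A t
          rw [this]
          exact add_mem (sub_mem (q.mul_mem_left _ (hm 0)) (q.mul_mem_left _ (hm 1)))
            (q.mul_mem_left _ (hm 2))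
        exact hq.mem_of_pow_mem 2 hs
    refine (Ideal.height_le_card_of_mem_minimalPrimes_span (Set.toFinite _) hmin).trans ?_
    have := (Set.ncard_insert_le (coord A t 0) {coord A t 1, coord A t 2}).trans
      (Nat.add_le_add_right (Set.ncard_insert_le _ _) 1)
    rw [Set.ncard_singleton] at this
    exact_mod_cast this
  -- Restriction to the curve v = 0 in D, a copy of the integral curve-like locus C; its kernel is
  -- the middle prime of the chain.
  · let χ : HatRing A t →+* CoverRing A t := (Polynomial.evalRingHom 0).comp (toLine A t 1 1)
    have hχ (i) : χ (coord A t i) = ![0, 0, CoverRing.s A t, CoverRing.s A t] i := by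
      rw [RingHom.comp_apply, toLine_coord]
      fin_cases i <;> simp
    have hkp : (RingHom.ker χ).IsPrime := RingHom.ker_isPrime _
    have h1 : lineIdeal A t 1 1 < RingHom.ker χ := by
      rw [← ker_toLine]
      refine lt_of_le_of_ne (fun r hr ↦ ?_) fun h ↦ ?_
      · rw [RingHom.mem_ker] at hr ⊢
        rw [RingHom.comp_apply, hr, map_zero]
      · have : coord A t 0 ∈ RingHom.ker χ := by rw [RingHom.mem_ker, hχ]; rfl
        rw [← h, RingHom.mem_ker, toLine_coord] at this
        exact Polynomial.X_ne_zero this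
    have hle : RingHom.ker χ ≤ idealVertex A t := by
      intro r hr
      rw [← Ideal.Quotient.eq_zero_iff_mem,
        ← mk_ofLine_toLine 1 1 (lineIdeal_le_idealVertex 1 1), Ideal.Quotient.eq_zero_iff_mem]
      rw [RingHom.mem_ker, RingHom.comp_apply, Polynomial.coe_evalRingHom,
        ← Polynomial.coeff_zero_eq_eval_zero, ← Polynomial.X_dvd_iff] at hr
      obtain ⟨g, hg⟩ := hr
      rw [hg, map_mul]
      refine Ideal.mul_mem_right _ _ ?_
      have hX : ofLine (A := A) (t := t) .X = coord A t 0 := Polynomial.eval₂_X ..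
      exact hX ▸ hv 0
    have h2 : RingHom.ker χ < p := by
      refine lt_of_le_of_ne (hle.trans hp.1.2) fun h ↦ ?_
      have hm : coord A t 3 ∈ p := hp.1.2 (hv 3)
      rw [← h, RingHom.mem_ker, hχ] at hm
      exact CoverRing.s_ne_zero hm
    have e1 := Ideal.height_add_one_le_of_lt_of_isPrime h1
    have e2 := Ideal.height_add_one_le_of_lt_of_isPrime h2
    rw [height_lineIdeal_one_one] at e1
    calc (3 : ℕ∞) = 1 + 1 + 1 := by norm_num
      _ ≤ (RingHom.ker χ).height + 1 := by gcongr
      _ ≤ _ := e2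

end HatRing

end
end ADETransform

namespace ADETransform
noncomputable section

/-! ### Invertible modules over finite algebras -/

section Invertible

/-- By integrality all maximal ideals of R lie over that of S, and the fibre of a finite algebra is
finite. -/
theorem finite_maximalSpectrum_of_isLocalRing (S R : Type*) [CommRing S] [CommRing R] [Algebra S R]
    [IsLocalRing S] [Module.Finite S R] : Finite (MaximalSpectrum R) := by
  have hfin := Algebra.QuasiFinite.finite_primesOver (R := S) (S := R) (IsLocalRing.maximalIdeal S)
  have : Finite ((IsLocalRing.maximalIdeal S).primesOver R) := hfin
  refine Finite.of_injective (β := (IsLocalRing.maximalIdeal S).primesOver R)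
    (fun m ↦ ⟨m.asIdeal, m.isMaximal.isPrime, ⟨?_⟩⟩) fun m m' h ↦
      MaximalSpectrum.ext (congrArg Subtype.val h)
  have := m.isMaximal
  exact (IsLocalRing.eq_maximalIdeal
    (Ideal.isMaximal_comap_of_isIntegral_of_isMaximal (R := S) m.asIdeal)).symm

/-- An invertible module over a finite `S`-algebra is generated by one element near any given point
of `Spec S`. -/
theorem exists_generator_of_invertible {S R : Type*} [CommRing S] [CommRing R] [Algebra S R]
    [Module.Finite S R] (M : Type*) [AddCommGroup M] [Module R M] [Module.Invertible R M]
    (q : Ideal S) [q.IsPrime] :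
    ∃ m : M, ∃ f : S, f ∉ q ∧ ∀ m' : M, ∃ r : R, algebraMap S R f • m' = r • m := by
  let T := Algebra.algebraMapSubmonoid R q.primeCompl
  have : Module.Finite (Localization.AtPrime q) (Localization T) :=
    Module.Finite.of_isLocalization S R q.primeCompl
  have := finite_maximalSpectrum_of_isLocalRing (Localization.AtPrime q) (Localization T)
  -- R localized along the fibre over q is semilocal, where invertible modules are free. Localizing
  -- by elements of S rather than of R is what makes the trivialization valid over a neighbourhood
  -- in Spec S.
  have : Module.Free (Localization T) (LocalizedModule T M) := inferInstance
  obtain ⟨e⟩ := Module.Invertible.free_iff_linearEquiv.mp this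
  obtain ⟨⟨m, c⟩, hm⟩ := IsLocalizedModule.surj T (LocalizedModule.mkLinearMap T M) (e.symm 1)
  have hgen (m' : M) : ∃ f ∈ T, ∃ r : R, f • m' = r • m := by
    obtain ⟨⟨r, d⟩, hr⟩ := IsLocalization.surj T (e (LocalizedModule.mkLinearMap T M m'))
    have h1 : (c * d : R) • LocalizedModule.mkLinearMap T M m' =
        r • LocalizedModule.mkLinearMap T M m := by
      rw [← hm]
      refine e.injective ?_
      simp only [Submonoid.smul_def]
      rw [← IsScalarTower.algebraMap_smul (Localization T) (c * d : R),
        ← IsScalarTower.algebraMap_smul (Localization T) r,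
        ← IsScalarTower.algebraMap_smul (Localization T) (c : R), map_smul, map_smul, map_smul,
        e.apply_symm_apply]
      simp only [smul_eq_mul, mul_one, ← hr, map_mul]
      ring
    rw [← map_smul, ← map_smul] at h1
    obtain ⟨k, hk⟩ := IsLocalizedModule.exists_of_eq (S := T) h1
    refine ⟨k * (c * d), mul_mem k.2 (mul_mem c.2 d.2), k * r, ?_⟩
    exact (mul_smul _ _ _).trans (hk.trans (mul_smul _ _ _).symm)
  choose F hFT ρ hρ using hgen
  have hT : ∀ x ∈ T, ∃ f : S, f ∉ q ∧ algebraMap S R f = x := by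
    rintro _ ⟨f, hf, rfl⟩
    exact ⟨f, hf, rfl⟩
  obtain ⟨G, hG⟩ := (Module.Finite.fg_top : (⊤ : Submodule R M).FG)
  -- A finite generating set allows one common denominator, the product of the individual ones,
  -- which still comes from outside q.
  obtain ⟨f, hf, hfF⟩ := hT (∏ x ∈ G, F x) (prod_mem fun x _ ↦ hFT x)
  refine ⟨m, f, hf, fun m' ↦ ?_⟩
  have hm' : m' ∈ Submodule.span R (G : Set M) := hG ▸ Submodule.mem_top
  rw [hfF]
  induction hm' using Submodule.span_induction with
  | mem x hx =>
    obtain ⟨k, hk⟩ := Finset.dvd_prod_of_mem F hx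
    exact ⟨k * ρ x, by rw [hk, mul_comm, mul_smul, hρ, mul_smul]⟩
  | zero => exact ⟨0, by simp⟩
  | add x y _ _ hx hy =>
    obtain ⟨a, ha⟩ := hx
    obtain ⟨b, hb⟩ := hy
    exact ⟨a + b, by rw [smul_add, ha, hb, add_smul]⟩
  | smul c x _ hx =>
    obtain ⟨a, ha⟩ := hx
    exact ⟨c * a, by rw [smul_comm, ha, mul_smul]⟩

/-- Inverting f kills the cokernel and preserves injectivity. -/
theorem locallyFreeOfRankAt_of_injective {S : Type u} [CommRing S] {N : Type v} [AddCommGroup N]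
    [Module S N] {n : ℕ} {q : PrimeSpectrum S} {f : S} (hf : f ∉ q.asIdeal)
    (g : (Fin n → S) →ₗ[S] N) (hg : Function.Injective g) (hs : ∀ y, ∃ x, f • y = g x) :
    LocallyFreeOfRankAt S N n q := by
  refine ⟨f, hf, ?_⟩
  let T := Submonoid.powers f
  let ι : (Fin n → S) →ₗ[S] (Fin n → Localization T) :=
    .pi fun i ↦ Algebra.linearMap S (Localization T) ∘ₗ .proj i
  have : IsLocalizedModule T ι :=
      IsLocalizedModule.pi T fun _ ↦ Algebra.linearMap S (Localization T)
  let μ := LocalizedModule.mkLinearMap T N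
  let G := IsLocalizedModule.map T ι μ g
  have hGi : Function.Injective G := IsLocalizedModule.map_injective T ι μ g hg
  have hGs : Function.Surjective G := by
    intro y
    obtain ⟨⟨y, c⟩, rfl⟩ := IsLocalizedModule.mk'_surjective T μ y
    obtain ⟨x, hx⟩ := hs y
    refine ⟨IsLocalizedModule.mk' ι x (c * ⟨f, Submonoid.mem_powers f⟩), ?_⟩
    change IsLocalizedModule.map T ι μ g _ = IsLocalizedModule.mk' μ y c
    rw [IsLocalizedModule.map_mk', ← hx]
    exact IsLocalizedModule.mk'_cancel_right μ y c ⟨f, Submonoid.mem_powers f⟩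
  exact ⟨((LinearEquiv.ofBijective G ⟨hGi, hGs⟩).extendScalarsOfIsLocalization T
    (Localization T)).symm⟩

end Invertible

/-! ### The pushforward of the twisted Poincaré sheaf -/

section Transform

variable {A : Type u} [CommRing A] {t : A}

instance HatRing.finite_surfaceRing : Module.Finite (SurfaceRing A t) (HatRing A t) := by
  classical
  refine ⟨⟨{1, coord A t 3}, ?_⟩⟩
  rw [eq_top_iff]
  rintro r -
  obtain ⟨a, b, rfl⟩ := exists_eq_add_mul_coord r
  rw [Finset.coe_pair, Submodule.mem_span_pair]
  refine ⟨a, b, ?_⟩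
  rw [Algebra.smul_def, Algebra.smul_def, mul_one]
  rfl

variable [Algebra ℂ A] [IsDomain (CoverRing A t)]

theorem locallyFreeOfRankAt_pushforward_poincareSheaf (M : Type v) [AddCommGroup M]
    [Module (HatRing A t) M] [Module.Invertible (HatRing A t) M]
    (q : PrimeSpectrum (SurfaceRing A t)) :
    LocallyFreeOfRankAt (SurfaceRing A t) (Pushforward A t (poincareSheaf A t M)) 2 q := by
  obtain ⟨e⟩ := exists_linearEquiv_sheafD (A := A) (t := t)
  obtain ⟨b⟩ := exists_basis_lineIdeal (A := A) (t := t)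
  let J := HatRing.lineIdeal A t 1 (-1)
  have eM : J ⊗[HatRing A t] M ≃ₗ[HatRing A t] poincareSheaf A t M :=
    TensorProduct.congr e (LinearEquiv.refl (HatRing A t) M)
  refine LocallyFreeOfRankAt.congr (Pushforward.congr eM) ?_
  have : IsDomain (HatRing A t) := HatRing.isDomain
  obtain ⟨m, f, hf, hm⟩ := exists_generator_of_invertible (S := SurfaceRing A t)
    (R := HatRing A t) M q.asIdeal
  have hf0 : algebraMap (SurfaceRing A t) (HatRing A t) f ≠ 0 := by
    refine (map_ne_zero_iff _ HatRing.fromSurface_injective).mpr ?_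
    rintro rfl
    exact hf q.asIdeal.zero_mem
  -- j ↦ j ⊗ m trivializes the twist once f is inverted, f annihilating its cokernel. It is
  -- injective even before: if x m = 0 then x f annihilates the faithful module M, so x = 0 in the
  -- domain.
  let g₀ : J →ₗ[HatRing A t] J ⊗[HatRing A t] M := (TensorProduct.mk (HatRing A t) J M).flip m
  have hg₀ : Function.Injective g₀ := by
    rw [← LinearMap.ker_eq_bot, LinearMap.ker_eq_bot']
    intro x hx
    have hx' : (x : HatRing A t) • m = 0 := by
      have := congrArg
        ((TensorProduct.lid (HatRing A t) M).toLinearMap ∘ₗ LinearMap.rTensor M J.subtype) hx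
      simpa [g₀] using this
    have hann : ((x : HatRing A t) * algebraMap _ _ f) = 0 := by
      refine FaithfulSMul.eq_of_smul_eq_smul (α := M) fun m' ↦ ?_
      obtain ⟨r, hr⟩ := hm m'
      rw [mul_smul, hr, smul_comm, hx', smul_zero, zero_smul]
    exact Subtype.ext ((mul_eq_zero.mp hann).resolve_right hf0)
  have hs₀ : ∀ y : J ⊗[HatRing A t] M, ∃ x : J,
      algebraMap (SurfaceRing A t) (HatRing A t) f • y = g₀ x := by
    intro y
    induction y using TensorProduct.induction_on with
    | zero => exact ⟨0, by simp⟩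
    | add y z hy hz =>
      obtain ⟨a, ha⟩ := hy
      obtain ⟨c, hc⟩ := hz
      exact ⟨a + c, by rw [smul_add, ha, hc, map_add]⟩
    | tmul j m' =>
      obtain ⟨r, hr⟩ := hm m'
      refine ⟨r • j, ?_⟩
      rw [← TensorProduct.tmul_smul, hr, TensorProduct.tmul_smul, map_smul]
      rfl
  let g₁ : Pushforward A t J →ₗ[SurfaceRing A t] Pushforward A t (J ⊗[HatRing A t] M) :=
    { g₀.toAddMonoidHom with
      map_smul' := fun c x ↦ g₀.map_smul (algebraMap _ (HatRing A t) c) x }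
  let β : (Fin 2 → SurfaceRing A t) ≃ₗ[SurfaceRing A t] Pushforward A t J :=
    b.equivFun.symm ≪≫ₗ Pushforward.idealEquiv _
  refine locallyFreeOfRankAt_of_injective hf (g₁ ∘ₗ β.toLinearMap) ?_ fun y ↦ ?_
  · exact (show Function.Injective g₁ from hg₀).comp β.injective
  · obtain ⟨x, hx⟩ := hs₀ y
    obtain ⟨x', hx'⟩ := β.surjective x
    exact ⟨x', hx.trans (congrArg g₁ hx').symm⟩

/-- The pullback of L is invertible on `Ŷ` and is absorbed into the twist M by permuting tensor
factors. -/
theorem locallyFreeOfRankAt_transform (M : Type v) [AddCommGroup M]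
    [Module (HatRing A t) M] [Module.Invertible (HatRing A t) M]
    (L : Type w) [AddCommGroup L] [Module (CoverRing A t) L] [Module.Invertible (CoverRing A t) L]
    (q : PrimeSpectrum (SurfaceRing A t)) :
    LocallyFreeOfRankAt (SurfaceRing A t) (transform A t M L) 2 q :=
  (locallyFreeOfRankAt_pushforward_poincareSheaf (pullbackFromCover A t L ⊗[HatRing A t] M)
    q).congr (Pushforward.congr (TensorProduct.leftComm (HatRing A t) _ _ _))

end Transform

end
end ADETransform

namespace ADETransform
noncomputable section

/-! ### The morphism to the conifold -/

section ToConifold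

variable {A : Type u} [CommRing A] [Algebra ℂ A] {t : A}

theorem toConifold_coord (i : Fin 4) :
    toConifold A t (Conifold.coord i) = HatRing.coord A t i :=
  MvPolynomial.aeval_X (HatRing.coord A t) i

theorem toConifold_algebraMap (c : ℂ) :
    toConifold A t (algebraMap ℂ _ c) = algebraMap ℂ _ c :=
  MvPolynomial.aeval_C (HatRing.coord A t) c

/-- Over the affine line, t is eliminated by t = s². -/
theorem toConifold_bijective_polynomial :
    Function.Bijective (toConifold (Polynomial ℂ) Polynomial.X) := by
  have hX : (Polynomial.aeval (Conifold.coord 3 ^ 2) : Polynomial ℂ →ₐ[ℂ] Conifold)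
      Polynomial.X = Conifold.coord 3 ^ 2 := Polynomial.aeval_X _
  let g : HatRing (Polynomial ℂ) Polynomial.X →+* Conifold :=
    HatRing.lift (Polynomial.aeval (Conifold.coord 3 ^ 2) : Polynomial ℂ →ₐ[ℂ] Conifold).toRingHom
      Conifold.coord hX.symm (hX.symm ▸ by linear_combination -Conifold.relation)
  have hg (a : Polynomial ℂ) : g (algebraMap _ _ a) = Polynomial.aeval (Conifold.coord 3 ^ 2) a :=
    HatRing.lift_algebraMap ..
  have hgc (i) : g (HatRing.coord _ _ i) = Conifold.coord i := HatRing.lift_coord ..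
  refine Function.bijective_iff_has_inverse.mpr ⟨g, fun r ↦ ?_, fun r ↦ ?_⟩
  · refine RingHom.congr_fun (f := g.comp (toConifold _ _)) (g := RingHom.id _)
      (Conifold.hom_ext (RingHom.ext fun c ↦ ?_) fun i ↦ ?_) r
    · rw [RingHom.comp_apply, RingHom.comp_apply, toConifold_algebraMap]
      exact (hg (Polynomial.C c)).trans (Polynomial.aeval_C _ c)
    · rw [RingHom.comp_apply, toConifold_coord, hgc, RingHom.id_apply]
  · refine RingHom.congr_fun (f := (toConifold _ _).comp g) (g := RingHom.id _)
      (HatRing.hom_ext (Polynomial.ringHom_ext (fun c ↦ ?_) ?_) fun i ↦ ?_) r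
    · rw [RingHom.comp_apply, RingHom.comp_apply, hg, Polynomial.aeval_C, toConifold_algebraMap]
      rfl
    · rw [RingHom.comp_apply, RingHom.comp_apply, hg, Polynomial.aeval_X, map_pow,
        toConifold_coord, HatRing.coord_three_sq]
      rfl
    · rw [RingHom.comp_apply, hgc, toConifold_coord, RingHom.id_apply]

/-- `Ŷ` is the fibre product of the conifold and B over 𝔸¹, by s² and t; smoothness of t is stable
under base change. The maps `k` and `j` are the mutually inverse identifications. -/
theorem toConifold_smooth
    (ht : (Polynomial.aeval t : Polynomial ℂ →ₐ[ℂ] A).toRingHom.Smooth) :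
    (toConifold A t).Smooth := by
  let κ : Polynomial ℂ →ₐ[ℂ] Conifold := Polynomial.aeval (Conifold.coord 3 ^ 2)
  let α : Polynomial ℂ →ₐ[ℂ] A := Polynomial.aeval t
  let _ : Algebra (Polynomial ℂ) Conifold := κ.toRingHom.toAlgebra
  let _ : Algebra (Polynomial ℂ) A := α.toRingHom.toAlgebra
  let _ : Algebra (Polynomial ℂ) (HatRing A t) := ((algebraMap A _).comp α.toRingHom).toAlgebra
  have : Algebra.Smooth (Polynomial ℂ) A := ht
  have hκ : (toConifold A t).comp κ.toRingHom = (algebraMap A _).comp α.toRingHom := by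
    refine Polynomial.ringHom_ext (fun c ↦ ?_) ?_
    · simp only [RingHom.comp_apply, AlgHom.toRingHom_eq_coe, RingHom.coe_coe, κ, α,
        Polynomial.aeval_C, toConifold_algebraMap]
      rfl
    · simp only [RingHom.comp_apply, AlgHom.toRingHom_eq_coe, RingHom.coe_coe, κ, α,
        Polynomial.aeval_X, map_pow, toConifold_coord, HatRing.coord_three_sq]
  let k : Conifold ⊗[Polynomial ℂ] A →ₐ[Polynomial ℂ] HatRing A t :=
    Algebra.TensorProduct.productMap
      { toConifold A t with commutes' := fun c ↦ RingHom.congr_fun hκ c }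
      { algebraMap A (HatRing A t) with commutes' := fun c ↦ rfl }
  have hk1 (c : Conifold) : k (c ⊗ₜ 1) = toConifold A t c :=
    Algebra.TensorProduct.productMap_left_apply _ _ c
  have hk2 (a : A) : k (1 ⊗ₜ a) = algebraMap A _ a :=
    Algebra.TensorProduct.productMap_right_apply _ _ a
  have hX : (Conifold.coord 3 ^ 2 : Conifold) ⊗ₜ[Polynomial ℂ] (1 : A) = 1 ⊗ₜ t := by
    have h1 : algebraMap (Polynomial ℂ) Conifold Polynomial.X = Conifold.coord 3 ^ 2 :=
      Polynomial.aeval_X _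
    have h2 : algebraMap (Polynomial ℂ) A Polynomial.X = t := Polynomial.aeval_X _
    rw [← h1, ← h2, Algebra.algebraMap_eq_smul_one, TensorProduct.smul_tmul,
      ← Algebra.algebraMap_eq_smul_one]
  let inc := (Algebra.TensorProduct.includeLeftRingHom : Conifold →+* Conifold ⊗[Polynomial ℂ] A)
  let j : HatRing A t →+* Conifold ⊗[Polynomial ℂ] A :=
    HatRing.lift (Algebra.TensorProduct.includeRight :
        A →ₐ[Polynomial ℂ] Conifold ⊗[Polynomial ℂ] A).toRingHom
      (fun i ↦ inc (Conifold.coord i))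
      (by rw [← map_pow]; exact hX)
      (by
        rw [← map_pow, ← map_pow, ← map_pow, ← map_sub, ← map_add]
        refine Eq.trans ?_ hX
        have : Conifold.coord 0 ^ 2 - Conifold.coord 1 ^ 2 + Conifold.coord 2 ^ 2 =
          Conifold.coord 3 ^ 2 := by linear_combination -Conifold.relation
        rw [this]
        rfl)
  have hj1 (a : A) : j (algebraMap A _ a) = 1 ⊗ₜ a := HatRing.lift_algebraMap ..
  have hj2 (i) : j (HatRing.coord A t i) = inc (Conifold.coord i) := HatRing.lift_coord ..
  have hjk : j.comp (toConifold A t) = inc := by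
    refine Conifold.hom_ext (RingHom.ext fun c ↦ ?_) fun i ↦ ?_
    · rw [RingHom.comp_apply, RingHom.comp_apply, toConifold_algebraMap]
      refine (hj1 (algebraMap ℂ A c)).trans ?_
      have h1 : algebraMap (Polynomial ℂ) Conifold (Polynomial.C c) = algebraMap ℂ _ c :=
        Polynomial.aeval_C _ _
      have h2 : algebraMap (Polynomial ℂ) A (Polynomial.C c) = algebraMap ℂ _ c :=
        Polynomial.aeval_C _ _
      rw [← h2, Algebra.algebraMap_eq_smul_one, ← TensorProduct.smul_tmul,
        ← Algebra.algebraMap_eq_smul_one, h1]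
      rfl
    · rw [RingHom.comp_apply, toConifold_coord, hj2]
  have hbij : Function.Bijective k.toRingHom := by
    refine Function.bijective_iff_has_inverse.mpr ⟨j, fun r ↦ ?_, fun r ↦ ?_⟩
    · change j (k r) = r
      induction r using TensorProduct.induction_on with
      | zero => rw [map_zero, map_zero]
      | add x y hx hy => rw [map_add, map_add, hx, hy]
      | tmul c a =>
        have hca : c ⊗ₜ[Polynomial ℂ] a = (c ⊗ₜ 1) * (1 ⊗ₜ a) := by simp
        rw [hca, map_mul, map_mul, hk1, hk2, hj1]
        have : j (toConifold A t c) = inc c := RingHom.congr_fun hjk c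
        rw [this]
        rfl
    · refine RingHom.congr_fun (f := k.toRingHom.comp j) (g := RingHom.id _)
        (HatRing.hom_ext (RingHom.ext fun a ↦ ?_) fun i ↦ ?_) r
      · rw [RingHom.comp_apply, RingHom.comp_apply, hj1]
        exact hk2 a
      · rw [RingHom.comp_apply, hj2]
        exact (hk1 _).trans (toConifold_coord i)
  have hcomp : toConifold A t =
      k.toRingHom.comp (algebraMap Conifold (Conifold ⊗[Polynomial ℂ] A)) :=
    RingHom.ext fun c ↦ (hk1 c).symm
  rw [hcomp]
  refine RingHom.Smooth.comp ?_ (RingHom.smooth_def.2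
    ⟨.of_bijective hbij, .of_bijective hbij⟩)
  rw [RingHom.smooth_algebraMap]
  infer_instance

/-! ### The smooth locus -/

/-- Approximate points of the conifold with an invertible coordinate lift to points. -/
theorem Conifold.exists_lift {B : Type*} [CommRing B] [Algebra ℂ B] (I : Ideal B) (hI : I ^ 2 = ⊥)
    (g : Conifold →+* B ⧸ I) (hg : ∀ c : ℂ,
      g (algebraMap ℂ _ c) = Ideal.Quotient.mk I (algebraMap ℂ B c))
    (i : Fin 4) (hi : IsUnit (g (coord i))) :
    ∃ h : Conifold →+* B, (Ideal.Quotient.mk I).comp h = g ∧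
      ∀ c : ℂ, h (algebraMap ℂ _ c) = algebraMap ℂ B c := by
  choose b hb using fun j ↦ Ideal.Quotient.mk_surjective (I := I) (g (coord j))
  have hu : IsUnit (b i) := by
    refine (IsNilpotent.isUnit_quotient_mk_iff ⟨2, hI⟩).mp ?_
    rw [hb]
    exact hi
  obtain ⟨v, hv⟩ := ((isUnit_two_of_algebra_complex (algebraMap ℂ B)).mul hu).exists_right_inv
  set F := b 3 ^ 2 - b 0 ^ 2 + b 1 ^ 2 - b 2 ^ 2 with hF
  have hFI : F ∈ I := by
    rw [← Ideal.Quotient.eq_zero_iff_mem]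
    simp only [F, map_sub, map_add, map_pow, hb]
    rw [← map_pow, ← map_pow, ← map_pow, ← map_pow, ← map_sub, ← map_add, ← map_sub, relation,
      map_zero]
  have hF2 : F ^ 2 = 0 := by
    have : F ^ 2 ∈ I ^ 2 := Ideal.pow_mem_pow hFI 2
    rwa [hI] at this
  obtain ⟨b', hb', hrel⟩ : ∃ b' : Fin 4 → B, (∀ j, Ideal.Quotient.mk I (b' j) = g (coord j)) ∧
      b' 3 ^ 2 - b' 0 ^ 2 + b' 1 ^ 2 - b' 2 ^ 2 = 0 := by
    -- One Newton step in the i-th coordinate: the vector holds the signs of the quadric, v inverts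
    -- 2 b i, and the error is a multiple of F² = 0.
    refine ⟨Function.update b i (b i - ![-1, 1, -1, 1] i * F * v), fun j ↦ ?_, ?_⟩
    · by_cases hji : j = i
      · subst hji
        rw [Function.update_self, map_sub, map_mul, map_mul,
          Ideal.Quotient.eq_zero_iff_mem.mpr hFI, mul_zero, zero_mul, sub_zero, hb]
      · rw [Function.update_of_ne hji, hb]
    · fin_cases i
      · simp [Function.update] at hv ⊢
        linear_combination - v ^ 2 * hF2 - F * hv - hF
      · simp [Function.update] at hv ⊢
        linear_combination v ^ 2 * hF2 - F * hv - hF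
      · simp [Function.update] at hv ⊢
        linear_combination - v ^ 2 * hF2 - F * hv - hF
      · simp [Function.update] at hv ⊢
        linear_combination v ^ 2 * hF2 - F * hv - hF
  refine ⟨lift (algebraMap ℂ B) b' hrel, hom_ext (RingHom.ext fun c ↦ ?_) fun j ↦ ?_,
    lift_algebraMap _ _ _⟩
  · rw [RingHom.comp_apply, RingHom.comp_apply, lift_algebraMap, RingHom.comp_apply, hg]
  · rw [RingHom.comp_apply, lift_coord, hb']

/-- Infinitesimal lifting in two stages: first the image point of the conifold, whose i-th
coordinate is a unit, then the point of `Ŷ` over it by smoothness of `toConifold`. -/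
theorem HatRing.isSmoothAt_of_coord_notMem
    (ht : (Polynomial.aeval t : Polynomial ℂ →ₐ[ℂ] A).toRingHom.Smooth)
    (p : Ideal (HatRing A t)) [p.IsPrime] {i : Fin 4} (hi : coord A t i ∉ p) :
    Algebra.IsSmoothAt ℂ p := by
  let _ : Algebra Conifold (HatRing A t) := (toConifold A t).toAlgebra
  have : Algebra.Smooth Conifold (HatRing A t) := toConifold_smooth ht
  have : Algebra.FormallySmooth (HatRing A t) (Localization.AtPrime p) :=
    .of_isLocalization p.primeCompl
  have : Algebra.FormallySmooth Conifold (Localization.AtPrime p) :=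
    .comp Conifold (HatRing A t) (Localization.AtPrime p)
  have hC (c : ℂ) : algebraMap Conifold (Localization.AtPrime p) (algebraMap ℂ _ c) =
      algebraMap ℂ _ c := by
    rw [IsScalarTower.algebraMap_apply Conifold (HatRing A t),
      IsScalarTower.algebraMap_apply ℂ (HatRing A t) (Localization.AtPrime p)]
    exact congrArg _ (toConifold_algebraMap c)
  refine .of_comp_surjective fun B _ _ I hI g ↦ ?_
  obtain ⟨h, hh, hhC⟩ := Conifold.exists_lift I hI
    (g.toRingHom.comp (algebraMap Conifold (Localization.AtPrime p))) (fun c ↦ by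
      simp only [RingHom.comp_apply, hC, AlgHom.toRingHom_eq_coe, RingHom.coe_coe, AlgHom.commutes]
      rfl) i (by
      rw [RingHom.comp_apply]
      refine IsUnit.map g.toRingHom ?_
      rw [IsScalarTower.algebraMap_apply Conifold (HatRing A t)]
      have : algebraMap Conifold (HatRing A t) (Conifold.coord i) = coord A t i :=
        toConifold_coord i
      rw [this]
      exact IsLocalization.map_units (M := p.primeCompl) _ ⟨_, hi⟩)
  let _ : Algebra Conifold B := h.toAlgebra
  let g' : Localization.AtPrime p →ₐ[Conifold] B ⧸ I :=
    { g with commutes' := fun c ↦ (RingHom.congr_fun hh c).symm }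
  obtain ⟨f, hf⟩ := Algebra.FormallySmooth.comp_surjective Conifold (Localization.AtPrime p) I hI g'
  refine ⟨{ f with commutes' := fun c ↦ ?_ }, AlgHom.ext fun x ↦ DFunLike.congr_fun hf x⟩
  change f (algebraMap ℂ _ c) = _
  rw [← hC, AlgHom.commutes]
  exact hhC c

/-- A formally smooth algebra has no homomorphism to a quotient `K / (F)` of a local domain by a
non-degenerate quadric which extends to the quadric cone. -/
theorem false_of_algHom_quotient_quadric {K P : Type*} [CommRing K] [IsLocalRing K] [IsDomain K]
    [Algebra ℂ K] [CommRing P] [Algebra ℂ P] [Algebra.FormallySmooth ℂ P] {x : Fin 4 → P}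
    (hx : x 3 ^ 2 - x 0 ^ 2 + x 1 ^ 2 - x 2 ^ 2 = 0) {z : Fin 4 → K}
    (hz : ∀ i, z i ∈ IsLocalRing.maximalIdeal K) {F : K}
    (hF : F = z 3 ^ 2 - z 0 ^ 2 + z 1 ^ 2 - z 2 ^ 2) (hF0 : F ≠ 0)
    (g : P →ₐ[ℂ] K ⧸ Ideal.span {F}) (hg : ∀ i, g (x i) = Ideal.Quotient.mk _ (z i)) : False := by
  have hle : Ideal.span {F ^ 2} ≤ Ideal.span {F} :=
    Ideal.span_singleton_le_span_singleton.mpr (dvd_pow_self F two_ne_zero)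
  let θ : (K ⧸ Ideal.span {F ^ 2}) →ₐ[ℂ] K ⧸ Ideal.span {F} := Ideal.Quotient.factorₐ ℂ hle
  have hθ (k : K) : θ (Ideal.Quotient.mk _ k) = Ideal.Quotient.mk _ k := rfl
  have hθs : Function.Surjective θ := fun y ↦ by
    obtain ⟨k, rfl⟩ := Ideal.Quotient.mk_surjective y
    exact ⟨Ideal.Quotient.mk _ k, rfl⟩
  have hker : RingHom.ker θ ≤ Ideal.span {Ideal.Quotient.mk (Ideal.span {F ^ 2}) F} := by
    intro y hy
    obtain ⟨k, rfl⟩ := Ideal.Quotient.mk_surjective y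
    rw [RingHom.mem_ker, hθ, Ideal.Quotient.eq_zero_iff_mem, Ideal.mem_span_singleton] at hy
    rw [Ideal.mem_span_singleton]
    exact map_dvd _ hy
  have hφ : (Ideal.Quotient.mk (Ideal.span {F ^ 2}) F) ^ 2 = 0 := by
    rw [← map_pow]
    exact Ideal.Quotient.eq_zero_iff_mem.mpr (Ideal.mem_span_singleton_self _)
  have hnil : IsNilpotent (RingHom.ker θ) := by
    refine ⟨2, le_bot_iff.mp ((Ideal.pow_right_mono hker 2).trans ?_)⟩
    rw [Ideal.span_singleton_pow, hφ]
    exact Ideal.span_le.mpr (by simp)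
  -- Formal smoothness lifts g from K/(F) to K/(F²), sending x i to z i + F (a i). The quadric
  -- relation becomes F + 2 F e + F² (…) ∈ (F²); cancelling F puts 1 in the maximal ideal, since e
  -- and F lie there.
  let σ := Algebra.FormallySmooth.liftOfSurjective g θ hθs hnil
  have hσ (r) : θ (σ r) = g r := Algebra.FormallySmooth.liftOfSurjective_apply g θ hθs hnil r
  have hY (i) : ∃ a : K, σ (x i) = Ideal.Quotient.mk _ (z i + F * a) := by
    obtain ⟨k, hk⟩ := Ideal.Quotient.mk_surjective (σ (x i))
    have h1 : Ideal.Quotient.mk (Ideal.span {F}) k = Ideal.Quotient.mk _ (z i) := by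
      rw [← hθ, hk, hσ, hg]
    rw [Ideal.Quotient.eq, Ideal.mem_span_singleton] at h1
    obtain ⟨a, ha⟩ := h1
    exact ⟨a, by rw [← ha, ← hk]; congr 1; ring⟩
  choose a ha using hY
  have hrel := congrArg σ hx
  simp only [map_sub, map_add, map_pow, map_zero, ha] at hrel
  simp only [← map_pow, ← map_sub, ← map_add] at hrel
  rw [Ideal.Quotient.eq_zero_iff_mem, Ideal.mem_span_singleton] at hrel
  obtain ⟨c, hc⟩ := hrel
  set e : K := z 3 * a 3 - z 0 * a 0 + z 1 * a 1 - z 2 * a 2 with he'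
  have he : e ∈ IsLocalRing.maximalIdeal K :=
    sub_mem (add_mem (sub_mem (Ideal.mul_mem_right _ _ (hz 3)) (Ideal.mul_mem_right _ _ (hz 0)))
      (Ideal.mul_mem_right _ _ (hz 1))) (Ideal.mul_mem_right _ _ (hz 2))
  have hFm : F ∈ IsLocalRing.maximalIdeal K := by
    have h2 (i) := Ideal.pow_mem_of_mem _ (hz i) 2 two_pos
    rw [hF]
    exact sub_mem (add_mem (sub_mem (h2 3) (h2 0)) (h2 1)) (h2 2)
  have hone : 1 = F * (c - (a 3 ^ 2 - a 0 ^ 2 + a 1 ^ 2 - a 2 ^ 2)) - 2 * e := by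
    refine mul_left_cancel₀ hF0 ?_
    linear_combination hc + hF - 2 * F * he'
  have : (1 : K) ∈ IsLocalRing.maximalIdeal K := by
    rw [hone]
    exact sub_mem (Ideal.mul_mem_right _ _ hFm) (Ideal.mul_mem_left _ _ he)
  exact (IsLocalRing.mem_maximalIdeal 1).mp this isUnit_one

/-- A hypersurface given by a non-degenerate quadric in four functions is not smooth at the common
zeros of the four functions. -/
theorem not_isSmoothAt_of_ker_eq_span_quadric {Q R : Type*} [CommRing Q] [IsDomain Q] [Algebra ℂ Q]
    [CommRing R] [Algebra ℂ R] {π : Q →ₐ[ℂ] R} (hπ : Function.Surjective π) {x : Fin 4 → Q}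
    (hf0 : x 3 ^ 2 - x 0 ^ 2 + x 1 ^ 2 - x 2 ^ 2 ≠ 0)
    (hker : RingHom.ker π = Ideal.span {x 3 ^ 2 - x 0 ^ 2 + x 1 ^ 2 - x 2 ^ 2})
    (p : Ideal R) [p.IsPrime] (hp : ∀ i, π (x i) ∈ p) : ¬ Algebra.IsSmoothAt ℂ p := by
  intro hsm
  have hsm : Algebra.FormallySmooth ℂ (Localization.AtPrime p) := hsm
  set f := x 3 ^ 2 - x 0 ^ 2 + x 1 ^ 2 - x 2 ^ 2 with hf
  have hq : (p.comap π.toRingHom).IsPrime := inferInstance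
  generalize hqdef : p.comap π.toRingHom = q at hq
  have hmem (y : Q) : y ∈ q ↔ π y ∈ p := by rw [← hqdef]; rfl
  have hF0 : algebraMap Q (Localization.AtPrime q) f ≠ 0 :=
    (map_ne_zero_iff _ (IsLocalization.injective _ q.primeCompl_le_nonZeroDivisors)).mpr hf0
  have hX (i) : algebraMap Q (Localization.AtPrime q) (x i) ∈
      IsLocalRing.maximalIdeal (Localization.AtPrime q) := by
    rw [IsLocalization.AtPrime.to_map_mem_maximal_iff _ q, hmem]
    exact hp i
  let μ : Q →ₐ[ℂ] Localization.AtPrime q ⧸ Ideal.span {algebraMap Q (Localization.AtPrime q) f} :=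
    (Ideal.Quotient.mkₐ ℂ _).comp (IsScalarTower.toAlgHom ℂ Q (Localization.AtPrime q))
  have hμ (y) : μ y = Ideal.Quotient.mk _ (algebraMap Q (Localization.AtPrime q) y) := rfl
  have hμker : ∀ y ∈ RingHom.ker π, μ y = 0 := by
    intro y hy
    rw [hker, Ideal.mem_span_singleton] at hy
    rw [hμ, Ideal.Quotient.eq_zero_iff_mem, Ideal.mem_span_singleton]
    exact map_dvd _ hy
  -- The map R = Q/(f) → Q_q/(f) inverts everything outside p, so it extends to R_p and plays the
  -- role of g in `false_of_algHom_quotient_quadric`.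
  let ρ := (Ideal.Quotient.liftₐ (RingHom.ker π) μ hμker).comp
    (Ideal.quotientKerAlgEquivOfSurjective hπ).symm.toAlgHom
  have hρ (y : Q) : ρ (π y) = μ y := by
    have : (Ideal.quotientKerAlgEquivOfSurjective hπ).symm (π y) = Ideal.Quotient.mk _ y := by
      rw [AlgEquiv.symm_apply_eq]
      rfl
    change Ideal.Quotient.liftₐ (RingHom.ker π) μ hμker
      ((Ideal.quotientKerAlgEquivOfSurjective hπ).symm (π y)) = _
    rw [this]
    rfl
  have hunit : ∀ y : p.primeCompl, IsUnit (ρ y) := by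
    rintro ⟨y, hy⟩
    obtain ⟨y, rfl⟩ := hπ y
    change IsUnit (ρ (π y))
    rw [hρ, hμ]
    have : IsUnit (algebraMap Q (Localization.AtPrime q) y) :=
      IsLocalization.map_units (M := q.primeCompl) _ ⟨y, fun h ↦ hy ((hmem y).mp h)⟩
    exact this.map _
  let g := IsLocalization.liftAlgHom (S := Localization.AtPrime p) hunit
  have hg (r : R) : g (algebraMap R _ r) = ρ r := IsLocalization.lift_eq hunit r
  refine false_of_algHom_quotient_quadric (x := fun i ↦ algebraMap R _ (π (x i))) ?_ hX
    (by rw [hf]; simp only [map_sub, map_add, map_pow]) hF0 g fun i ↦ ?_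
  · have : π f = 0 := by
      rw [← RingHom.mem_ker, hker]
      exact Ideal.mem_span_singleton_self _
    have := congrArg (algebraMap R (Localization.AtPrime p)) this
    rw [hf] at this
    simpa only [map_sub, map_add, map_pow, map_zero] using this
  · rw [hg, hρ, hμ]

/-- `Ŷ` is the hypersurface s² - x² + y² - z² = 0 in affine three-space over C, with s a function on
C. The equation is nonzero because its constant coefficient is s² ≠ 0. -/
theorem HatRing.not_isSmoothAt [IsDomain (CoverRing A t)] (p : Ideal (HatRing A t)) [p.IsPrime]
    (hp : idealVertex A t ≤ p) : ¬ Algebra.IsSmoothAt ℂ p := by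
  have : Nontrivial A := (algebraMap A (CoverRing A t)).domain_nontrivial
  let _ : Algebra ℂ (CoverRing A t) := ((algebraMap A _).comp (algebraMap ℂ A)).toAlgebra
  let π₀ : MvPolynomial (Fin 3) (CoverRing A t) →+* HatRing A t :=
    MvPolynomial.eval₂Hom (fromCover A t).toRingHom fun i ↦ coord A t i.castSucc
  have hπC (c) : π₀ (.C c) = fromCover A t c := MvPolynomial.eval₂_C _ _ _
  have hπX' (i) : π₀ (.X i) = coord A t i.castSucc := MvPolynomial.eval₂_X _ _ _
  let π : MvPolynomial (Fin 3) (CoverRing A t) →ₐ[ℂ] HatRing A t :=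
    { π₀ with commutes' := fun c ↦ (hπC _).trans ((fromCover A t).commutes _) }
  have hππ (y) : π y = π₀ y := rfl
  clear_value π₀
  let X : Fin 4 → MvPolynomial (Fin 3) (CoverRing A t) :=
    ![.X 0, .X 1, .X 2, .C (CoverRing.s A t)]
  have hπX (i) : π (X i) = coord A t i := by
    rw [hππ]
    fin_cases i
    · exact hπX' 0
    · exact hπX' 1
    · exact hπX' 2
    · exact hπC _
  have hπs : Function.Surjective π := by
    intro r
    have h1 (a : SurfaceRing A t) : fromSurface A t a ∈ π₀.range := by
      obtain ⟨a, rfl⟩ := Ideal.Quotient.mk_surjective a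
      refine ⟨MvPolynomial.map (algebraMap A _) a, ?_⟩
      refine RingHom.congr_fun (f := π₀.comp (MvPolynomial.map (algebraMap A _)))
        (g := (fromSurface A t).toRingHom.comp (Ideal.Quotient.mk _))
        (MvPolynomial.ringHom_ext (fun c ↦ ?_) fun i ↦ ?_) a
      · rw [RingHom.comp_apply, MvPolynomial.map_C]
        refine (hπC _).trans ?_
        exact ((fromCover A t).commutes c).trans ((fromSurface A t).commutes c).symm
      · rw [RingHom.comp_apply, MvPolynomial.map_X]
        exact (hπX' _).trans (fromSurface_coord i).symm
    have h3 : coord A t 3 ∈ π₀.range := ⟨X 3, hπX 3⟩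
    obtain ⟨a, b, rfl⟩ := exists_eq_add_mul_coord r
    exact add_mem (h1 a) (mul_mem (h1 b) h3)
  refine not_isSmoothAt_of_ker_eq_span_quadric hπs (x := X) ?_ (le_antisymm ?_ ?_) p
    fun i ↦ hπX i ▸ hp (Ideal.subset_span ⟨i, rfl⟩)
  · intro h
    have h' := congrArg MvPolynomial.constantCoeff h
    simp only [X, Matrix.cons_val, map_sub, map_add, map_pow, MvPolynomial.constantCoeff_X,
      MvPolynomial.constantCoeff_C, map_zero] at h'
    exact CoverRing.s_ne_zero (c := t) (by simpa using h')
  -- The universal property of `Ŷ` gives a map ρ back to the quotient by the quadric with ρ ∘ π₀ =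
  -- μ, so the kernel is no larger than the quadric ideal.
  · let μ := Ideal.Quotient.mk (Ideal.span {X 3 ^ 2 - X 0 ^ 2 + X 1 ^ 2 - X 2 ^ 2})
    have hμf : μ (X 3) ^ 2 - μ (X 0) ^ 2 + μ (X 1) ^ 2 - μ (X 2) ^ 2 = 0 := by
      simp only [← map_pow, ← map_sub, ← map_add]
      exact Ideal.Quotient.eq_zero_iff_mem.mpr (Ideal.mem_span_singleton_self _)
    have hs : μ (X 3) ^ 2 = ((μ.comp MvPolynomial.C).comp (algebraMap A _)) t := by
      change μ (.C (CoverRing.s A t)) ^ 2 = μ (.C (algebraMap A _ t))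
      rw [← CoverRing.s_sq, map_pow, map_pow]
    let ρ := lift ((μ.comp MvPolynomial.C).comp (algebraMap A _)) (fun i ↦ μ (X i)) hs (by
      linear_combination hs - hμf)
    have hρX (i) : ρ (coord A t i) = μ (X i) := lift_coord ..
    have hρA (a) : ρ (fromCover A t (algebraMap A _ a)) = μ (.C (algebraMap A _ a)) := by
      rw [(fromCover A t).commutes]
      exact lift_algebraMap ..
    have hρs : ρ (fromCover A t (CoverRing.s A t)) = μ (.C (CoverRing.s A t)) := hρX 3
    have hρC (c) : ρ (fromCover A t c) = μ (.C c) := by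
      obtain ⟨a, b, rfl⟩ := CoverRing.exists_eq_add_mul_s c
      simp only [map_add, map_mul, hρA, hρs]
    intro y hy
    have hρπ : ρ.comp π₀ = μ := by
      refine MvPolynomial.ringHom_ext (fun c ↦ ?_) fun i ↦ ?_
      · rw [RingHom.comp_apply, hπC, hρC]
      · rw [RingHom.comp_apply, hπX', hρX]
        fin_cases i <;> rfl
    rw [← Ideal.Quotient.eq_zero_iff_mem]
    refine (RingHom.congr_fun hρπ y).symm.trans ?_
    rw [RingHom.comp_apply, ← hππ, (RingHom.mem_ker).mp hy, map_zero]
  · rw [Ideal.span_singleton_le_iff_mem, RingHom.mem_ker]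
    simp only [map_sub, map_add, map_pow, hπX, relation]

theorem HatRing.mem_smoothLocus_iff [IsDomain (CoverRing A t)]
    (ht : (Polynomial.aeval t : Polynomial ℂ →ₐ[ℂ] A).toRingHom.Smooth)
    (p : PrimeSpectrum (HatRing A t)) :
    p ∈ Algebra.smoothLocus ℂ (HatRing A t) ↔ ¬ idealVertex A t ≤ p.asIdeal := by
  refine ⟨fun h hp ↦ not_isSmoothAt p.asIdeal hp h, fun h ↦ ?_⟩
  rw [idealVertex, Ideal.span_le, Set.not_subset] at h
  obtain ⟨_, ⟨i, rfl⟩, hi⟩ := h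
  exact isSmoothAt_of_coord_notMem ht p.asIdeal hi

end ToConifold

end
end ADETransform

/-! ### The local model of the transform at a generic branch point -/

open ADETransform in
theorem mainTheorem1
    (A : Type u) [CommRing A] [IsDomain A] [Algebra ℂ A] (t : A)
    (ht : (Polynomial.aeval t : Polynomial ℂ →ₐ[ℂ] A).toRingHom.Smooth) (ht₀ : ¬ IsUnit t) :
    -- the fibre product and its conifold singularities, in codimension three
    (IsDomain (HatRing A t) ∧
      (toConifold A t).Smooth ∧
      HatRing.idealVertex A t ≠ ⊤ ∧
      (∀ p : PrimeSpectrum (HatRing A t),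
        p ∈ Algebra.smoothLocus ℂ (HatRing A t) ↔ ¬ HatRing.idealVertex A t ≤ p.asIdeal) ∧
      (∀ p ∈ (HatRing.idealVertex A t).minimalPrimes, p.height = 3) ∧
      Function.Bijective (toConifold (Polynomial ℂ) Polynomial.X)) ∧
    -- `D` is a prime Weil divisor which is not Cartier exactly at the singularities
    (idealD A t = Ideal.span {HatRing.coord A t 0 - HatRing.coord A t 1,
        HatRing.coord A t 2 - HatRing.coord A t 3} ∧
      (idealD A t).IsPrime ∧
      (idealD A t).height = 1 ∧
      (∀ p : PrimeSpectrum (HatRing A t),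
        CartierAt (HatRing A t) (idealD A t) p ↔ ¬ HatRing.idealVertex A t ≤ p.asIdeal)) ∧
    -- `O(D)` is coherent of rank one, and not locally free exactly at the singularities
    (Module.Finite (HatRing A t) (sheafD A t) ∧
      Module.finrank (HatRing A t) (sheafD A t) = 1 ∧
      (∀ p : PrimeSpectrum (HatRing A t),
        LocallyFreeOfRankAt (HatRing A t) (sheafD A t) 1 p ↔
          ¬ HatRing.idealVertex A t ≤ p.asIdeal)) ∧
    -- the pushforward of the Poincaré sheaf, untwisted and twisted by a line bundle
    Nonempty (Pushforward A t (sheafD A t) ≃ₗ[SurfaceRing A t]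
      SurfaceRing A t × SurfaceRing A t) ∧
    (∀ (M : Type v) [AddCommGroup M] [Module (HatRing A t) M]
      [Module.Invertible (HatRing A t) M] (q : PrimeSpectrum (SurfaceRing A t)),
      LocallyFreeOfRankAt (SurfaceRing A t) (Pushforward A t (poincareSheaf A t M)) 2 q) ∧
    -- the transform of a line bundle on the spectral cover
    (∀ (M : Type v) [AddCommGroup M] [Module (HatRing A t) M]
      [Module.Invertible (HatRing A t) M]
      (L : Type w) [AddCommGroup L] [Module (CoverRing A t) L]
      [Module.Invertible (CoverRing A t) L] (q : PrimeSpectrum (SurfaceRing A t)),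
      LocallyFreeOfRankAt (SurfaceRing A t) (transform A t M L) 2 q) ∧
    -- the ideal `(x - y, z + s)`
    (∃ b : Module.Basis (Fin 2) (MvPolynomial (Fin 3) ℂ) Conifold.idealDPrime,
      (b 0 : Conifold) = Conifold.coord 0 - Conifold.coord 1 ∧
      (b 1 : Conifold) = Conifold.coord 2 + Conifold.coord 3) := by 
  have hC : IsDomain (CoverRing A t) := CoverRing.isDomain_of_smooth ht ht₀
  have hN : IsNoetherianRing A := isNoetherianRing_of_smooth ht
  refine ⟨⟨HatRing.isDomain, toConifold_smooth ht, HatRing.idealVertex_ne_top ht₀,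
      HatRing.mem_smoothLocus_iff ht, fun p hp ↦ HatRing.height_eq_three hp,
      toConifold_bijective_polynomial⟩,
    ⟨by rw [idealD_eq_lineIdeal, HatRing.lineIdeal_one_one], ?_, ?_, fun p ↦ ?_⟩,
    ⟨finite_sheafD, finrank_sheafD, locallyFreeOfRankAt_sheafD_iff⟩,
    exists_linearEquiv_pushforward_sheafD,
    fun M _ _ _ q ↦ locallyFreeOfRankAt_pushforward_poincareSheaf M q,
    fun M _ _ _ L _ _ _ q ↦ locallyFreeOfRankAt_transform M L q,
    Conifold.exists_basis_idealDPrime⟩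
  · rw [idealD_eq_lineIdeal]
    infer_instance
  · rw [idealD_eq_lineIdeal]
    exact HatRing.height_lineIdeal_one_one
  · rw [idealD_eq_lineIdeal]
    exact HatRing.cartierAt_lineIdeal_iff 1 1 p
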